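/- All monoids are commutative. A \emph{monoid with zero} is a (multiplicative) monoid $A$ with an element $0$ such that $0\cdot a=0$ for all $a$; a prime ideal of $A$ is a subset $\mathfrak p\ni 0$ with $\mathfrak pA\subseteq\mathfrak p$ whose complement is a submonoid. With the Zariski topology and the structure sheaf built from the localizations $A_{\mathfrak p}$ (exactly as for rings), the set $\operatorname{Spec}A$ of prime ideals is a space with a sheaf of monoids with zero. An \emph{$\mathcal M_0$-scheme} is a topological space with a sheaf of monoids with zero that is locally isomorphic to such spectra. The base extension $\widetilde X_{\mathbb Z}$ of an $\mathcal M_0$-scheme $\widetilde X$ is the scheme obtained by gluing the affine schemes $\operatorname{Spec}\bigl(\mathbb Z[A]/(1\cdot 0_A)\bigr)$ over the affine open subsets $\operatorname{Spec}A\subseteq\widetilde X$; an open subset $\widetilde Y\subseteq\widetilde X$ yields an open subscheme $\widetilde Y_{\mathbb Z}\subseteq\widetilde X_{\mathbb Z}$. A \emph{CC-scheme} is a triple $(\widetilde X,X,e_X)$ consisting of an $\mathcal M_0$-scheme $\widetilde X$, a scheme $X$ and a morphism $e_X:\widetilde X_{\mathbb Z}\to X$ such that $e_X(k):\widetilde X_{\mathbb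 Z}(k)\to X(k)$ is bijective for every field $k$. A \emph{torification} of a scheme $X$ is a morphism $e:T\to X$ from a disjoint union $T=\coprod_{i\in I}\mathbb G_m^{d_i}$ of split tori over $\mathbb Z$ ($d_i\in\mathbb Z_{\ge 0}$) such that the restriction of $e$ to each $\mathbb G_m^{d_i}$ is a (locally closed) immersion and $e(k):T(k)\to X(k)$ is bijective for every field $k$; $X$ is \emph{torified} if it admits a torification. \textbf{Statement.} Let $(\widetilde X,X,e_X)$ be a CC-scheme. Suppose that $\widetilde X$ is integral (in every stalk $\mathcal O_{\widetilde X,x}$, $ab=ac$ and $a\ne 0$ imply $b=c$) and torsion-free (in every stalk, $a^n=b^n$ with $n\geq 1$ implies $a=b$), and that the unit group $\mathcal O_{\widetilde X,x}^\times$ is finitely generated for every $x\in\widetilde X$. If the restriction of $e_X$ to $\widetilde Y_{\mathbb Z}$ is an immersion for every connected component $\widetilde Y$ of $\widetilde X$, then the scheme $X$ is torified. -/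

import Mathlib

open CategoryTheory CategoryTheory.Limits TopologicalSpace Opposite AlgebraicGeometry

universe u

noncomputable section

namespace F1

/-! ### The category of commutative monoids with zero -/

/-- The category `𝓜₀` of commutative monoids with zero; morphisms are the multiplicative maps that
preserve `1` and `0`. -/
structure MonZero : Type (u + 1) where
  carrier : Type u
  [str : CommMonoidWithZero carrier]

attribute [instance] MonZero.str

namespace MonZero

instance : CoeSort MonZero.{u} (Type u) := ⟨MonZero.carrier⟩

abbrev of (A : Type u) [CommMonoidWithZero A] : MonZero.{u} := ⟨A⟩

@[ext]
structure Hom (A B : MonZero.{u}) where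
  toHom : A →*₀ B

instance : Category MonZero.{u} where
  Hom A B := Hom A B
  id A := ⟨MonoidWithZeroHom.id A⟩
  comp f g := ⟨g.toHom.comp f.toHom⟩

instance : ConcreteCategory MonZero.{u} (fun A B => A →*₀ B) where
  hom := Hom.toHom
  ofHom := Hom.mk

abbrev hom {A B : MonZero.{u}} (f : A ⟶ B) : A →*₀ B := ConcreteCategory.hom f

abbrev ofHom {A B : Type u} [CommMonoidWithZero A] [CommMonoidWithZero B] (f : A →*₀ B) :
    of A ⟶ of B :=
  ConcreteCategory.ofHom (C := MonZero) f

theorem isIso_of_bijective {A B : MonZero.{u}} (f : A ⟶ B) (h : Function.Bijective (hom f)) :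
    IsIso f := by
  let e : A ≃* B := MulEquiv.ofBijective (hom f) h
  let g : B ⟶ A := ⟨{ e.symm.toMonoidHom with map_zero' := map_zero e.symm }⟩
  refine ⟨g, ?_, ?_⟩
  · apply ConcreteCategory.hom_ext
    intro x
    exact e.symm_apply_apply x
  · apply ConcreteCategory.hom_ext
    intro x
    exact e.apply_symm_apply x

theorem bijective_of_isIso {A B : MonZero.{u}} (f : A ⟶ B) [IsIso f] :
    Function.Bijective (hom f) := by
  constructor
  · intro x y hxy
    have := congrArg (hom (inv f)) hxy
    rwa [← ConcreteCategory.comp_apply, ← ConcreteCategory.comp_apply, IsIso.hom_inv_id] at this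
  · intro y
    refine ⟨hom (inv f) y, ?_⟩
    rw [← ConcreteCategory.comp_apply, IsIso.inv_hom_id]
    rfl

end MonZero

/-! ### The spectrum of a commutative monoid with zero -/

/-- A prime ideal of a commutative monoid with zero: a subset that contains `0`, is stable under
multiplication by arbitrary elements, and whose complement is a submonoid. -/
@[ext]
structure PrimeIdeal (A : Type u) [CommMonoidWithZero A] where
  carrier : Set A
  zero_mem : (0 : A) ∈ carrier
  mul_mem : ∀ a b : A, a ∈ carrier → a * b ∈ carrier
  one_notMem : (1 : A) ∉ carrier
  mem_or_mem : ∀ a b : A, a * b ∈ carrier → a ∈ carrier ∨ b ∈ carrier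

section Spectrum

variable {A : Type u} [CommMonoidWithZero A]

namespace PrimeIdeal

instance : Membership A (PrimeIdeal A) := ⟨fun p a => a ∈ p.carrier⟩

/-- The complement of a prime ideal, as a submonoid. -/
def compl (p : PrimeIdeal A) : Submonoid A where
  carrier := {a | a ∉ p}
  one_mem' := p.one_notMem
  mul_mem' {a b} ha hb h := (p.mem_or_mem a b h).elim ha hb

theorem mem_compl {p : PrimeIdeal A} {a : A} : a ∈ p.compl ↔ a ∉ p := Iff.rfl

theorem mul_mem_right (p : PrimeIdeal A) {a : A} (b : A) (h : b ∈ p) : a * b ∈ p := by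
  rw [mul_comm]
  exact p.mul_mem b a h

theorem pow_notMem (p : PrimeIdeal A) {a : A} (h : a ∉ p) (n : ℕ) : a ^ n ∉ p :=
  p.compl.pow_mem h n

theorem unit_notMem (p : PrimeIdeal A) {a : A} (h : IsUnit a) : a ∉ p := by
  obtain ⟨b, hb⟩ := h.exists_right_inv
  intro ha
  exact p.one_notMem (hb ▸ p.mul_mem a b ha)

/-- The Zariski topology: the closed sets are the sets `V(I) = {p | I ⊆ p}`. As `V(I)` only depends
on the ideal generated by `I`, it does not matter whether `I` runs over ideals or over subsets. -/
instance : TopologicalSpace (PrimeIdeal A) where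
  IsOpen U := ∃ I : Set A, ∀ p, p ∈ U ↔ ∃ a ∈ I, a ∉ p
  isOpen_univ := ⟨{1}, fun p => by
    simp only [Set.mem_univ, Set.mem_singleton_iff, exists_eq_left, true_iff]
    exact p.one_notMem⟩
  isOpen_inter := by
    rintro U V ⟨I, hI⟩ ⟨J, hJ⟩
    refine ⟨Set.image2 (· * ·) I J, fun p => ?_⟩
    constructor
    · rintro ⟨hU, hV⟩
      obtain ⟨a, ha, hap⟩ := (hI p).1 hU
      obtain ⟨b, hb, hbp⟩ := (hJ p).1 hV
      exact ⟨a * b, ⟨a, ha, b, hb, rfl⟩, p.compl.mul_mem hap hbp⟩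
    · rintro ⟨_, ⟨a, ha, b, hb, rfl⟩, h⟩
      exact ⟨(hI p).2 ⟨a, ha, fun h0 => h (p.mul_mem a b h0)⟩,
        (hJ p).2 ⟨b, hb, fun h0 => h (p.mul_mem_right b h0)⟩⟩
  isOpen_sUnion := by
    intro S hS
    choose! I hI using hS
    refine ⟨⋃ U ∈ S, I U, fun p => ?_⟩
    constructor
    · rintro ⟨U, hU, hp⟩
      obtain ⟨a, ha, hap⟩ := (hI U hU p).1 hp
      exact ⟨a, Set.mem_biUnion hU ha, hap⟩
    · rintro ⟨a, ha, hap⟩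
      obtain ⟨U, hU, haU⟩ := Set.mem_iUnion₂.1 ha
      exact ⟨U, hU, (hI U hU p).2 ⟨a, haU, hap⟩⟩

/-- The basic open set `D(a) = {p | a ∉ p}`. -/
def basicOpen (a : A) : Opens (PrimeIdeal A) :=
  ⟨{p | a ∉ p}, {a}, fun p => by simp⟩

theorem mem_basicOpen {a : A} {p : PrimeIdeal A} : p ∈ basicOpen a ↔ a ∉ p := Iff.rfl

theorem exists_basicOpen {U : Opens (PrimeIdeal A)} {p : PrimeIdeal A} (hp : p ∈ U) :
    ∃ a : A, p ∈ basicOpen a ∧ basicOpen a ≤ U := by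
  obtain ⟨I, hI⟩ := U.2
  obtain ⟨a, ha, hap⟩ := (hI p).1 hp
  exact ⟨a, hap, fun q hq => (hI q).2 ⟨a, ha, hq⟩⟩

end PrimeIdeal

variable (A) in
/-- The topological space `Spec A`. -/
abbrev specTop : TopCat.{u} := TopCat.of (PrimeIdeal A)

/-- The localization `A_p` of `A` at a prime ideal `p`. -/
abbrev LocAt (p : PrimeIdeal A) : Type u := Localization p.compl

variable (A) in
/-- A function `s` with `s(p) ∈ A_p` is a quotient if there are `a, f ∈ A` such that `f ∉ p` and
`s(p) = a / f` for all `p`. -/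
def isQuotient : TopCat.PrelocalPredicate (X := specTop A) (fun p => LocAt (A := A) p) where
  pred {U} s := ∃ a f : A, ∀ p : U, ∃ h : f ∈ PrimeIdeal.compl p.1, s p = Localization.mk a ⟨f, h⟩
  res := by
    rintro U V i s ⟨a, f, h⟩
    exact ⟨a, f, fun p => h ⟨p.1, i.le p.2⟩⟩

variable (A) in
/-- The functions `s` with `s(p) ∈ A_p` that are locally quotients of elements of `A`. -/
def isLocQuotient : TopCat.LocalPredicate (X := specTop A) (fun p => LocAt (A := A) p) :=
  (isQuotient A).sheafify

/-- The sections of the structure sheaf of `Spec A` over `U`. -/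
def SpecSec (U : Opens (specTop A)) : Type u :=
  {s : ∀ p : U, LocAt (A := A) p.1 // (isLocQuotient A).pred s}

namespace SpecSec

variable {U V : Opens (specTop A)}

@[ext]
theorem ext {s t : SpecSec U} (h : ∀ p, s.1 p = t.1 p) : s = t := Subtype.ext (funext h)

theorem exists_quotient (s : SpecSec U) {p : PrimeIdeal A} (hp : p ∈ U) :
    ∃ g : A, p ∈ PrimeIdeal.basicOpen g ∧ ∃ hU : PrimeIdeal.basicOpen g ≤ U, ∃ a f : A,
      ∀ q (hq : q ∈ PrimeIdeal.basicOpen g), ∃ h : f ∈ PrimeIdeal.compl q,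
        s.1 ⟨q, hU hq⟩ = Localization.mk a ⟨f, h⟩ := by
  obtain ⟨W, hW, i, a, f, h⟩ := s.2 ⟨p, hp⟩
  obtain ⟨g, hg, hgW⟩ := PrimeIdeal.exists_basicOpen hW
  exact ⟨g, hg, hgW.trans i.le, a, f, fun q hq => h ⟨q, hgW hq⟩⟩

theorem pred_of_exists (s : ∀ p : U, LocAt (A := A) p.1)
    (h : ∀ p (_ : p ∈ U), ∃ g : A, p ∈ PrimeIdeal.basicOpen g ∧
      ∃ hU : PrimeIdeal.basicOpen g ≤ U, ∃ a f : A,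
      ∀ q (hq : q ∈ PrimeIdeal.basicOpen g), ∃ h : f ∈ PrimeIdeal.compl q,
        s ⟨q, hU hq⟩ = Localization.mk a ⟨f, h⟩) : (isLocQuotient A).pred s := by
  intro p
  obtain ⟨g, hg, hU, a, f, h⟩ := h p.1 p.2
  exact ⟨PrimeIdeal.basicOpen g, hg, homOfLE hU, a, f, fun q => h q.1 q.2⟩

instance : One (SpecSec U) := ⟨⟨fun _ => 1, fun p => ⟨U, p.2, 𝟙 _, 1, 1, fun q =>
  ⟨q.1.compl.one_mem, Localization.mk_one.symm⟩⟩⟩⟩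

instance : Zero (SpecSec U) := ⟨⟨fun _ => 0, fun p => ⟨U, p.2, 𝟙 _, 0, 1, fun q =>
  ⟨q.1.compl.one_mem, (Localization.mk_zero (1 : q.1.compl)).symm⟩⟩⟩⟩

instance : Mul (SpecSec U) := ⟨fun s t => ⟨fun p => s.1 p * t.1 p,
  (isQuotient A).sheafify_inductionOn₂' (isQuotient A) (isQuotient A) (fun a b => a * b) (by
    rintro U V s t ⟨a, f, h⟩ ⟨b, g, k⟩
    refine ⟨a * b, f * g, fun p => ?_⟩
    obtain ⟨hf, hs⟩ := h ⟨p.1, p.2.1⟩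
    obtain ⟨hg, ht⟩ := k ⟨p.1, p.2.2⟩
    refine ⟨(PrimeIdeal.compl p.1).mul_mem hf hg, ?_⟩
    exact (congrArg₂ (· * ·) hs ht).trans (Localization.mk_mul _ _ _ _)) s.2 t.2⟩⟩

instance : CommMonoidWithZero (SpecSec U) where
  mul_assoc s t r := SpecSec.ext fun p => mul_assoc (s.1 p) (t.1 p) (r.1 p)
  one_mul s := SpecSec.ext fun p => one_mul (s.1 p)
  mul_one s := SpecSec.ext fun p => mul_one (s.1 p)
  mul_comm s t := SpecSec.ext fun p => mul_comm (s.1 p) (t.1 p)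
  zero_mul s := SpecSec.ext fun p => zero_mul (s.1 p)
  mul_zero s := SpecSec.ext fun p => mul_zero (s.1 p)

theorem mul_val (s t : SpecSec U) (p : U) : (s * t).1 p = s.1 p * t.1 p := rfl

theorem one_val (p : U) : (1 : SpecSec U).1 p = 1 := rfl

theorem zero_val (p : U) : (0 : SpecSec U).1 p = 0 := rfl

/-- Restriction of sections. -/
def res (h : V ≤ U) : SpecSec U →*₀ SpecSec V where
  toFun s := ⟨fun p => s.1 ⟨p.1, h p.2⟩, (isLocQuotient A).res (homOfLE h) s.1 s.2⟩
  map_zero' := rfl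
  map_one' := rfl
  map_mul' _ _ := rfl

end SpecSec

variable (A) in
/-- The structure presheaf of `Spec A`. -/
def specPresheaf : TopCat.Presheaf MonZero.{u} (specTop A) where
  obj U := MonZero.of (SpecSec (unop U))
  map i := MonZero.ofHom (SpecSec.res i.unop.le)

variable (A) in
/-- The spectrum of a commutative monoid with zero, with its Zariski topology and its structure
sheaf. -/
abbrev Spec0 : PresheafedSpace MonZero.{u} where
  carrier := specTop A
  presheaf := specPresheaf A

variable (A) in
theorem specPresheaf_isSheaf :
    TopCat.Presheaf.IsSheaf (specPresheaf A ⋙ CategoryTheory.forget MonZero.{u}) :=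
  TopCat.Presheaf.isSheaf_of_iso
    (NatIso.ofComponents (fun _ => Iso.refl _) (fun _ => rfl) :
      TopCat.subpresheafToTypes (isLocQuotient A).toPrelocalPredicate ≅
        specPresheaf A ⋙ CategoryTheory.forget MonZero.{u})
    (TopCat.subpresheafToTypes.isSheaf (isLocQuotient A))

end Spectrum

/-! ### Localizations give open immersions of spectra -/

section Localize

variable {A B : Type u} [CommMonoidWithZero A] [CommMonoidWithZero B]

/-- The preimage of a prime ideal. -/
def PrimeIdeal.comap (φ : A →*₀ B) (q : PrimeIdeal B) : PrimeIdeal A where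
  carrier := {a | φ a ∈ q}
  zero_mem := by
    change φ 0 ∈ q
    rw [map_zero]
    exact q.zero_mem
  mul_mem a b h := by
    change φ (a * b) ∈ q
    rw [map_mul]
    exact q.mul_mem _ _ h
  one_notMem h := by
    change φ 1 ∈ q at h
    rw [map_one] at h
    exact q.one_notMem h
  mem_or_mem a b h := by
    change φ (a * b) ∈ q at h
    rw [map_mul] at h
    exact q.mem_or_mem _ _ h

theorem PrimeIdeal.mem_comap {φ : A →*₀ B} {q : PrimeIdeal B} {a : A} :
    a ∈ q.comap φ ↔ φ a ∈ q := Iff.rfl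

theorem PrimeIdeal.continuous_comap (φ : A →*₀ B) : Continuous (PrimeIdeal.comap φ) := by
  refine ⟨?_⟩
  rintro U ⟨I, hI⟩
  refine ⟨φ '' I, fun q => (hI _).trans ?_⟩
  simp only [Set.exists_mem_image]
  rfl

/-- The canonical map `A → A_p`. -/
def toLocAt (p : PrimeIdeal A) : A →*₀ LocAt p :=
  { (Localization.monoidOf p.compl).toMonoidHom with
    map_zero' := (Localization.monoidOf p.compl).map_zero }

/-- The map `A_{φ⁻¹(q)} → B_q` induced by `φ : A → B`. -/
def locMap (φ : A →*₀ B) (q : PrimeIdeal B) : LocAt (q.comap φ) →*₀ LocAt q :=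
  (Localization.monoidOf (q.comap φ).compl).lift₀
    ((toLocAt q).comp φ)
    (fun y => (Localization.monoidOf q.compl).map_units ⟨φ y.1, y.2⟩)

theorem locMap_mk (φ : A →*₀ B) (q : PrimeIdeal B) (a : A) (s : A)
    (hs : s ∈ (q.comap φ).compl) :
    locMap φ q (Localization.mk a ⟨s, hs⟩) = Localization.mk (φ a) ⟨φ s, hs⟩ := by
  have h1 : ∀ x : A, locMap φ q (toLocAt _ x) = toLocAt q (φ x) := fun x =>
    (Localization.monoidOf (q.comap φ).compl).lift_eq _ x
  have h2 : ∀ (C : Type u) [CommMonoidWithZero C] (p : PrimeIdeal C) (x t : C) (ht : t ∈ p.compl),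
      (Localization.mk x ⟨t, ht⟩ : LocAt p) * toLocAt p t = toLocAt p x := by
    intro C _ p x t ht
    rw [Localization.mk_eq_monoidOf_mk']
    exact (Localization.monoidOf p.compl).mk'_spec x ⟨t, ht⟩
  have h3 : IsUnit (toLocAt q (φ s)) := (Localization.monoidOf q.compl).map_units ⟨φ s, hs⟩
  apply h3.mul_right_cancel
  refine Eq.trans ?_ (h2 B q (φ a) (φ s) hs).symm
  rw [← h1, ← map_mul, h2, h1]

/-- The morphism `Spec B → Spec A` induced by `φ : A → B`. -/
def specMap (φ : A →*₀ B) : Spec0 B ⟶ Spec0 A where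
  base := TopCat.ofHom ⟨PrimeIdeal.comap φ, PrimeIdeal.continuous_comap φ⟩
  c :=
    { app U := MonZero.ofHom
        { toFun s := ⟨fun q => locMap φ q.1 (s.1 ⟨q.1.comap φ, q.2⟩), by
            apply SpecSec.pred_of_exists
            intro q hq
            obtain ⟨g, hg, hU, a, f, h⟩ := SpecSec.exists_quotient s (p := q.comap φ) hq
            refine ⟨φ g, hg, fun p hp => hU (show g ∉ p.comap φ from hp), φ a, φ f, ?_⟩
            intro p hp
            obtain ⟨hf, hs⟩ := h (p.comap φ) hp
            refine ⟨hf, ?_⟩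
            exact (congrArg (locMap φ p) hs).trans (locMap_mk φ p a f hf)⟩
          map_zero' := SpecSec.ext fun q => map_zero (locMap φ q.1)
          map_one' := SpecSec.ext fun q => map_one (locMap φ q.1)
          map_mul' s t := SpecSec.ext fun q => map_mul (locMap φ q.1) _ _ }
      naturality _ _ _ := rfl }

theorem locMap_bijective {g : A} {φ : A →*₀ B}
    (hφ : Submonoid.IsLocalizationMap (Submonoid.powers g) φ) (q : PrimeIdeal B) :
    Function.Bijective (locMap φ q) := by
  have hg : ∀ n : ℕ, IsUnit (φ (g ^ n)) := fun n => hφ.map_units ⟨g ^ n, n, rfl⟩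
  have hsurj : ∀ b : B, ∃ a : A, ∃ n : ℕ, b * φ (g ^ n) = φ a := by
    intro b
    obtain ⟨⟨a, ⟨_, n, rfl⟩⟩, h⟩ := hφ.surj b
    exact ⟨a, n, h⟩
  have hu : ∀ (b : B) (n : ℕ), b ∉ q → b * φ (g ^ n) ∉ q := fun b n hb =>
    q.compl.mul_mem hb (q.unit_notMem (hg n))
  constructor
  · intro x y
    induction x using Localization.induction_on with | _ x
    induction y using Localization.induction_on with | _ y
    obtain ⟨a, s, hs⟩ := x
    obtain ⟨b, t, ht⟩ := y
    dsimp only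
    rw [locMap_mk, locMap_mk, Localization.mk_eq_mk_iff, Localization.mk_eq_mk_iff,
      Localization.r_iff_exists, Localization.r_iff_exists]
    rintro ⟨⟨c, hc⟩, h⟩
    dsimp only at h ⊢
    obtain ⟨c', n, hc'⟩ := hsurj c
    have h2 : φ (c' * (t * a)) = φ (c' * (s * b)) := by
      simp only [map_mul, ← hc']
      rw [mul_right_comm, h, mul_right_comm]
    obtain ⟨⟨_, m, rfl⟩, h3⟩ := hφ.exists_of_eq h2
    refine ⟨⟨g ^ m * c', ?_⟩, ?_⟩
    · apply Submonoid.mul_mem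
      · exact q.unit_notMem (hg m)
      · change φ c' ∉ q
        rw [← hc']
        exact hu c n hc
    · dsimp only at h3 ⊢
      rw [mul_assoc, h3, mul_assoc]
  · intro y
    induction y using Localization.induction_on with | _ y
    obtain ⟨b, u, hu'⟩ := y
    obtain ⟨a, n, hb⟩ := hsurj b
    obtain ⟨c, m, hc⟩ := hsurj u
    refine ⟨Localization.mk (a * g ^ m) ⟨c * g ^ n, ?_⟩, ?_⟩
    · change φ (c * g ^ n) ∉ q
      rw [map_mul, ← hc]
      exact hu _ _ (hu _ _ hu')
    · rw [locMap_mk, Localization.mk_eq_mk_iff, Localization.r_iff_exists]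
      refine ⟨1, ?_⟩
      simp only [map_mul, ← hb, ← hc]
      simp only [mul_comm, mul_left_comm]

variable {g : A} {φ : A →*₀ B}

theorem comap_injective (hφ : Submonoid.IsLocalizationMap (Submonoid.powers g) φ) :
    Function.Injective (PrimeIdeal.comap φ) := by
  have key : ∀ q q' : PrimeIdeal B, q.comap φ = q'.comap φ → ∀ b, b ∈ q → b ∈ q' := by
    intro q q' h b hb
    obtain ⟨⟨a, s⟩, hs⟩ := hφ.surj b
    have h1 : a ∈ q.comap φ := by
      rw [PrimeIdeal.mem_comap, ← hs]
      exact q.mul_mem _ _ hb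
    rw [h, PrimeIdeal.mem_comap, ← hs] at h1
    exact (q'.mem_or_mem _ _ h1).resolve_right (q'.unit_notMem (hφ.map_units s))
  intro q q' h
  ext b
  exact ⟨key q q' h b, key q' q h.symm b⟩

theorem range_comap (hφ : Submonoid.IsLocalizationMap (Submonoid.powers g) φ) :
    Set.range (PrimeIdeal.comap φ) = PrimeIdeal.basicOpen g := by
  have hg : ∀ s : Submonoid.powers g, IsUnit (φ s.1) := hφ.map_units
  ext p
  constructor
  · rintro ⟨q, rfl⟩
    exact q.unit_notMem (hg ⟨g, 1, pow_one g⟩)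
  · intro hp
    have hp' : ∀ s : Submonoid.powers g, s.1 ∉ p := by
      rintro ⟨_, n, rfl⟩
      exact p.pow_notMem hp n
    have key : ∀ a a' : A, φ a = φ a' → a ∈ p → a' ∈ p := by
      intro a a' h ha
      obtain ⟨c, hc⟩ := hφ.exists_of_eq h
      have : c.1 * a' ∈ p := hc ▸ p.mul_mem_right _ ha
      exact (p.mem_or_mem _ _ this).resolve_left (hp' c)
    refine ⟨⟨{b | ∃ a ∈ p, ∃ s : Submonoid.powers g, b * φ s.1 = φ a}, ?_, ?_, ?_, ?_⟩, ?_⟩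
    · exact ⟨0, p.zero_mem, 1, by simp⟩
    · rintro b c ⟨a, ha, s, hs⟩
      obtain ⟨⟨d, t⟩, ht⟩ := hφ.surj c
      refine ⟨a * d, p.mul_mem _ _ ha, s * t, ?_⟩
      rw [map_mul, ← hs, ← ht]
      simp only [Submonoid.coe_mul, map_mul]
      exact mul_mul_mul_comm _ _ _ _
    · rintro ⟨a, ha, s, hs⟩
      rw [one_mul] at hs
      exact hp' s (key _ _ hs.symm ha)
    · rintro b c ⟨a, ha, s, hs⟩
      obtain ⟨⟨d, t⟩, ht⟩ := hφ.surj b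
      obtain ⟨⟨e, r⟩, hr⟩ := hφ.surj c
      have h1 : φ (a * (t * r)) = φ (d * e * s) := by
        simp only [map_mul, ← hs]
        rw [← ht, ← hr]
        simp only [mul_comm, mul_left_comm, mul_assoc]
      have h2 := key _ _ h1 (p.mul_mem _ _ ha)
      have h3 := (p.mem_or_mem _ _ h2).resolve_right (hp' s)
      rcases p.mem_or_mem _ _ h3 with h | h
      · exact Or.inl ⟨d, h, t, ht⟩
      · exact Or.inr ⟨e, h, r, hr⟩
    · ext a
      constructor
      · rintro ⟨a', ha', s, hs⟩
        rw [← map_mul] at hs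
        exact (p.mem_or_mem _ _ (key _ _ hs.symm ha')).resolve_right (hp' s)
      · intro ha
        exact ⟨a, ha, 1, by simp⟩

theorem isOpenEmbedding_comap (hφ : Submonoid.IsLocalizationMap (Submonoid.powers g) φ) :
    Topology.IsOpenEmbedding (PrimeIdeal.comap φ) := by
  refine ⟨⟨⟨?_⟩, comap_injective hφ⟩, ?_⟩
  · apply le_antisymm
    · exact continuous_iff_le_induced.1 (PrimeIdeal.continuous_comap φ)
    · rintro U ⟨I, hI⟩
      refine isOpen_induced_iff.2
        ⟨{p | ∃ a, (∃ i ∈ I, ∃ s : Submonoid.powers g, φ a = i * φ s.1) ∧ a ∉ p},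
          ⟨_, fun _ => Iff.rfl⟩, ?_⟩
      ext q
      rw [hI]
      constructor
      · rintro ⟨a, ⟨i, hi, s, hs⟩, ha⟩
        refine ⟨i, hi, fun h => ha ?_⟩
        rw [PrimeIdeal.mem_comap, hs]
        exact q.mul_mem _ _ h
      · rintro ⟨i, hi, hq⟩
        obtain ⟨⟨a, s⟩, hs⟩ := hφ.surj i
        refine ⟨a, ⟨i, hi, s, hs.symm⟩, ?_⟩
        rw [PrimeIdeal.mem_comap, ← hs]
        exact q.compl.mul_mem hq (q.unit_notMem (hφ.map_units s))
  · rw [range_comap hφ]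
    exact (PrimeIdeal.basicOpen g).2

theorem specMap_app_bijective (hφ : Submonoid.IsLocalizationMap (Submonoid.powers g) φ)
    (U : Opens (specTop A)) (hU : ∀ p ∈ U, ∃ q : PrimeIdeal B, q.comap φ = p) :
    Function.Bijective (MonZero.hom ((specMap φ).c.app (op U))) := by
  constructor
  · intro s t h
    apply SpecSec.ext
    rintro ⟨p, hp⟩
    obtain ⟨q, rfl⟩ := hU p hp
    apply (locMap_bijective hφ q).1
    exact congrFun (congrArg Subtype.val h) ⟨q, hp⟩
  · intro r
    change SpecSec ((Opens.map (specMap φ).base).obj U) at r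
    have h1 : ∀ p : U, ∃ z : LocAt (A := A) p.1, ∀ (q : PrimeIdeal B) (h : q.comap φ = p.1),
        ∀ a f (hf : f ∈ PrimeIdeal.compl p.1), z = Localization.mk a ⟨f, hf⟩ →
          r.1 ⟨q, show q.comap φ ∈ U from h ▸ p.2⟩ =
            Localization.mk (φ a) ⟨φ f, show f ∈ (q.comap φ).compl by rw [h]; exact hf⟩ := by
      rintro ⟨p, hp⟩
      obtain ⟨q, rfl⟩ := hU p hp
      obtain ⟨z, hz⟩ := (locMap_bijective hφ q).2 (r.1 ⟨q, hp⟩)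
      refine ⟨z, fun q' h a f hf hza => ?_⟩
      obtain rfl := comap_injective hφ h
      rw [← hz, hza]
      exact locMap_mk φ q' a f hf
    choose z hz using h1
    have hz' : ∀ (q : PrimeIdeal B) (hq : q.comap φ ∈ U),
        locMap φ q (z ⟨q.comap φ, hq⟩) = r.1 ⟨q, hq⟩ := by
      intro q hq
      have h2 := hz ⟨q.comap φ, hq⟩ q rfl
      generalize z ⟨q.comap φ, hq⟩ = y at h2 ⊢
      induction y using Localization.induction_on with | _ y
      rw [h2 y.1 y.2.1 y.2.2 rfl]
      exact locMap_mk φ q y.1 y.2.1 y.2.2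
    refine ⟨⟨z, ?_⟩, SpecSec.ext fun q => hz' q.1 q.2⟩
    apply SpecSec.pred_of_exists
    intro p hp
    obtain ⟨q, rfl⟩ := hU p hp
    obtain ⟨d, hd, hdU, b, u, h⟩ := SpecSec.exists_quotient r (p := q) hp
    obtain ⟨⟨d', s⟩, hd'⟩ := hφ.surj d
    obtain ⟨⟨b', t⟩, hb'⟩ := hφ.surj b
    obtain ⟨⟨u', v⟩, hu'⟩ := hφ.surj u
    dsimp only at hd' hb' hu'
    have hun : ∀ (q' : PrimeIdeal B) (x : Submonoid.powers g), φ x.1 ∉ q' := fun q' x =>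
      q'.unit_notMem (hφ.map_units x)
    obtain ⟨e, he, heU⟩ := PrimeIdeal.exists_basicOpen (U := PrimeIdeal.basicOpen d' ⊓ U)
      (p := q.comap φ) ⟨by
        change φ d' ∉ q
        rw [← hd']
        exact q.compl.mul_mem hd (hun q s), hp⟩
    refine ⟨e, he, fun p hp => (heU hp).2, b' * v.1, u' * t.1, ?_⟩
    intro p hp'
    obtain ⟨q', rfl⟩ := hU p (heU hp').2
    have hq'd : q' ∈ PrimeIdeal.basicOpen d := by
      intro hdq
      have : φ d' ∉ q' := (heU hp').1
      rw [← hd'] at this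
      exact this (q'.mul_mem _ _ hdq)
    obtain ⟨hu, hr⟩ := h q' hq'd
    refine ⟨?_, ?_⟩
    · change φ (u' * t.1) ∉ q'
      rw [map_mul, ← hu']
      exact q'.compl.mul_mem (q'.compl.mul_mem hu (hun q' v)) (hun q' t)
    · apply (locMap_bijective hφ q').1
      rw [locMap_mk, hz' q' (heU hp').2, hr, Localization.mk_eq_mk_iff, Localization.r_iff_exists]
      refine ⟨1, ?_⟩
      simp only [map_mul, ← hb', ← hu']
      simp only [mul_comm, mul_left_comm]

theorem specMap_isOpenImmersion (hφ : Submonoid.IsLocalizationMap (Submonoid.powers g) φ) :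
    PresheafedSpace.IsOpenImmersion (specMap φ) where
  base_open := isOpenEmbedding_comap hφ
  c_iso U := by
    apply MonZero.isIso_of_bijective
    apply specMap_app_bijective hφ
    rintro p ⟨q, _, rfl⟩
    exact ⟨q, rfl⟩

end Localize

/-! ### Sections over basic open sets -/

section Sections

variable {A : Type u} [CommMonoidWithZero A]

/-- The section `a / 1`. -/
def toSec (U : Opens (specTop A)) : A →*₀ SpecSec U where
  toFun a := ⟨fun p => toLocAt (A := A) p.1 a, fun p => ⟨U, p.2, 𝟙 _, a, 1, fun q =>
    ⟨(PrimeIdeal.compl q.1).one_mem, rfl⟩⟩⟩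
  map_zero' := SpecSec.ext fun p => map_zero (toLocAt (A := A) p.1)
  map_one' := SpecSec.ext fun p => map_one (toLocAt (A := A) p.1)
  map_mul' a b := SpecSec.ext fun p => map_mul (toLocAt (A := A) p.1) a b

theorem toLocAt_eq (p : PrimeIdeal A) (a : A) :
    toLocAt p a = Localization.mk a ⟨1, p.compl.one_mem⟩ := rfl

/-- If `D(g)` is non-empty, it has a unique closed point. -/
theorem exists_closedPoint (g : A) (hg : ∀ n : ℕ, g ^ n ≠ 0) :
    ∃ p : PrimeIdeal A, ∀ a, a ∉ p ↔ ∃ (b : A) (n : ℕ), a * b = g ^ n := by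
  refine ⟨⟨{a | ¬ ∃ (b : A) (n : ℕ), a * b = g ^ n}, ?_, ?_, ?_, ?_⟩, fun a => ?_⟩
  · rintro ⟨b, n, h⟩
    rw [zero_mul] at h
    exact hg n h.symm
  · rintro a c h ⟨b, n, h'⟩
    exact h ⟨c * b, n, by rw [← mul_assoc, h']⟩
  · intro h
    exact h ⟨1, 0, by simp⟩
  · intro a c h
    by_contra hcon
    obtain ⟨h1, h2⟩ := not_or.1 hcon
    obtain ⟨b, n, hb⟩ := not_not.1 h1
    obtain ⟨d, m, hd⟩ := not_not.1 h2
    exact h ⟨b * d, n + m, by rw [mul_mul_mul_comm, hb, hd, pow_add]⟩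
  · exact not_not

theorem basicOpen_le_of_closedPoint {g : A} {p : PrimeIdeal A}
    (hp : ∀ a, a ∉ p ↔ ∃ (b : A) (n : ℕ), a * b = g ^ n) {U : Opens (PrimeIdeal A)}
    (hU : p ∈ U) : PrimeIdeal.basicOpen g ≤ U := by
  obtain ⟨a, ha, haU⟩ := PrimeIdeal.exists_basicOpen hU
  obtain ⟨b, n, hb⟩ := (hp a).1 ha
  refine le_trans (fun q hq => ?_) haU
  intro haq
  exact q.pow_notMem hq n (hb ▸ q.mul_mem a b haq)

theorem basicOpen_eq_bot {g : A} {n : ℕ} (hn : g ^ n = 0) (p : PrimeIdeal A) :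
    p ∉ PrimeIdeal.basicOpen g :=
  fun h => p.pow_notMem h n (hn ▸ p.zero_mem)

theorem toSec_isLocalizationMap (g : A) :
    Submonoid.IsLocalizationMap (Submonoid.powers g)
      (toSec (PrimeIdeal.basicOpen g : Opens (specTop A))) := by
  have hunit : ∀ n : ℕ, IsUnit (toSec (PrimeIdeal.basicOpen g : Opens (specTop A)) (g ^ n)) := by
    intro n
    rw [map_pow]
    apply IsUnit.pow
    refine IsUnit.of_mul_eq_one ⟨fun p => Localization.mk 1 ⟨g, p.2⟩, fun p => ⟨_, p.2, 𝟙 _, 1, g,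
      fun q => ⟨q.2, rfl⟩⟩⟩ (SpecSec.ext fun p => ?_)
    change toLocAt (A := A) p.1 g *
      Localization.mk 1 ⟨g, (show g ∈ PrimeIdeal.compl p.1 from p.2)⟩ = 1
    rw [toLocAt_eq, Localization.mk_mul, ← Localization.mk_one, Localization.mk_eq_mk_iff,
      Localization.r_iff_exists]
    exact ⟨1, by simp⟩
  by_cases hg : ∀ n : ℕ, g ^ n ≠ 0
  · obtain ⟨p, hp⟩ := exists_closedPoint g hg
    have hpg : p ∈ PrimeIdeal.basicOpen g := (hp g).2 ⟨1, 1, by simp⟩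
    refine ⟨?_, ?_, ?_⟩
    · rintro ⟨_, n, rfl⟩
      exact hunit n
    · intro s
      obtain ⟨d, hd, hdU, a, f, h⟩ := SpecSec.exists_quotient s hpg
      have hle := basicOpen_le_of_closedPoint hp hd
      obtain ⟨b, n, hb⟩ := (hp f).1 (h p hd).1
      refine ⟨⟨a * b, ⟨g ^ n, n, rfl⟩⟩, SpecSec.ext fun q => ?_⟩
      obtain ⟨hf, hs⟩ := h q.1 (hle q.2)
      rw [SpecSec.mul_val]
      change s.1 q * toLocAt (A := A) q.1 (g ^ n) = toLocAt (A := A) q.1 (a * b)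
      rw [hs, toLocAt_eq, toLocAt_eq, Localization.mk_mul, Localization.mk_eq_mk_iff,
        Localization.r_iff_exists]
      refine ⟨1, ?_⟩
      simp [← hb, mul_left_comm]
    · intro x y h
      have h1 : toLocAt p x = toLocAt p y := congrFun (congrArg Subtype.val h) ⟨p, hpg⟩
      rw [toLocAt_eq, toLocAt_eq, Localization.mk_eq_mk_iff, Localization.r_iff_exists] at h1
      obtain ⟨⟨c, hc⟩, hcxy⟩ := h1
      obtain ⟨b, n, hb⟩ := (hp c).1 hc
      refine ⟨⟨g ^ n, n, rfl⟩, ?_⟩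
      simp only [one_mul] at hcxy
      simp only [← hb]
      rw [mul_comm c b, mul_assoc, hcxy, mul_assoc]
  · push Not at hg
    obtain ⟨n, hn⟩ := hg
    have hsub : ∀ s t : SpecSec (PrimeIdeal.basicOpen g : Opens (specTop A)), s = t := fun s t =>
      SpecSec.ext fun p => absurd p.2 (basicOpen_eq_bot hn p.1)
    refine ⟨?_, ?_, ?_⟩
    · rintro ⟨_, n, rfl⟩
      exact hunit n
    · intro s
      exact ⟨1, hsub _ _⟩
    · intro x y _
      exact ⟨⟨g ^ n, n, rfl⟩, by simp [hn]⟩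

/-- A map is a localization at the powers of one element. -/
def IsLocAway {M N : Type u} [CommMonoidWithZero M] [CommMonoidWithZero N] (f : M →*₀ N)
    (g : M) : Prop :=
  Submonoid.IsLocalizationMap (Submonoid.powers g) f

theorem IsLocAway.of_equiv {M N M' N' : Type u} [CommMonoidWithZero M] [CommMonoidWithZero N]
    [CommMonoidWithZero M'] [CommMonoidWithZero N'] {f : M →*₀ N} {g : M} (h : IsLocAway f g)
    (f' : M' →*₀ N') (i : M →*₀ M') (j : N →*₀ N') (hi : Function.Bijective i)
    (hj : Function.Bijective j) (comm : ∀ x, f' (i x) = j (f x)) : IsLocAway f' (i g) := by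
  have hmem : ∀ n : ℕ, i g ^ n ∈ Submonoid.powers (i g) := fun n => ⟨n, rfl⟩
  refine ⟨?_, ?_, ?_⟩
  · rintro ⟨_, n, rfl⟩
    change IsUnit (f' (i g ^ n))
    rw [← map_pow i, comm]
    exact (h.map_units ⟨g ^ n, n, rfl⟩).map j
  · intro z
    obtain ⟨z, rfl⟩ := hj.2 z
    obtain ⟨⟨a, ⟨_, n, rfl⟩⟩, ha⟩ := h.surj z
    refine ⟨⟨i a, ⟨i g ^ n, hmem n⟩⟩, ?_⟩
    dsimp only at ha ⊢
    rw [comm, ← ha, map_mul, ← map_pow i, comm]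
  · intro x y hxy
    obtain ⟨x, rfl⟩ := hi.2 x
    obtain ⟨y, rfl⟩ := hi.2 y
    rw [comm, comm] at hxy
    obtain ⟨⟨_, n, rfl⟩, hc⟩ := h.exists_of_eq (hj.1 hxy)
    refine ⟨⟨i g ^ n, hmem n⟩, ?_⟩
    dsimp only at hc ⊢
    rw [← map_pow, ← map_mul, hc, map_mul]

theorem toSec_top_bijective : Function.Bijective (toSec (⊤ : Opens (specTop A))) := by
  have htop : (PrimeIdeal.basicOpen (1 : A) : Opens (specTop A)) = ⊤ :=
    top_le_iff.1 fun p _ => p.one_notMem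
  have h := toSec_isLocalizationMap (1 : A)
  rw [htop] at h
  have h1 : ∀ c : Submonoid.powers (1 : A), c.1 = 1 := by
    rintro ⟨_, n, rfl⟩
    exact one_pow n
  constructor
  · intro x y hxy
    obtain ⟨c, hc⟩ := h.exists_of_eq hxy
    simpa [h1 c] using hc
  · intro s
    obtain ⟨⟨a, c⟩, hc⟩ := h.surj s
    refine ⟨a, ?_⟩
    rw [← hc, h1 c, map_one, mul_one]

/-- The restriction from `Spec A` to `D(g)` is a localization at the powers of `g`. -/
theorem res_isLocAway {U V : Opens (specTop A)} (hUV : U ≤ V) (hV : V = ⊤) (g : A)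
    (hU : U = PrimeIdeal.basicOpen g) : IsLocAway (SpecSec.res hUV) (toSec V g) := by
  subst hV hU
  exact IsLocAway.of_equiv (f := toSec (PrimeIdeal.basicOpen g : Opens (specTop A)))
    (toSec_isLocalizationMap g) (SpecSec.res hUV) (toSec ⊤) (MonoidWithZeroHom.id _)
    toSec_top_bijective Function.bijective_id (fun _ => rfl)

end Sections

/-! ### Geometric `𝓜₀`-schemes -/

/-- An open subset `U` of a topological space with a presheaf of monoids with zero is affine if it
is the image of an open immersion from the spectrum of a monoid with zero, that is, if
`(U, 𝒪|_U)` is isomorphic to such a spectrum. -/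
def IsAffine0 (X : PresheafedSpace MonZero.{u}) (U : Opens X) : Prop :=
  ∃ (A : MonZero.{u}) (f : Spec0 A ⟶ X), PresheafedSpace.IsOpenImmersion f ∧
    Set.range f.base = (U : Set X)

/-- A geometric `𝓜₀`-scheme: a topological space with a sheaf of commutative monoids with zero that
has a covering by open subsets isomorphic to spectra. (A presheaf of monoids with zero is a sheaf if
and only if the underlying presheaf of sets is one.) -/
structure M0Scheme extends PresheafedSpace MonZero.{u} where
  isSheaf : TopCat.Presheaf.IsSheaf (presheaf ⋙ CategoryTheory.forget MonZero.{u})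
  exists_affine : ∀ x : carrier, ∃ U : Opens carrier, x ∈ U ∧ IsAffine0 toPresheafedSpace U

namespace IsAffine0

variable {X : PresheafedSpace MonZero.{u}}

theorem basicOpen {A : MonZero.{u}} (f : Spec0 A ⟶ X) [hf : PresheafedSpace.IsOpenImmersion f]
    (g : A) (U : Opens X) (hU : f.base '' (PrimeIdeal.basicOpen g : Set (PrimeIdeal A)) = U) :
    IsAffine0 X U := by
  let φ : A →*₀ Localization (Submonoid.powers g) :=
    { (Localization.monoidOf (Submonoid.powers g)).toMonoidHom with
      map_zero' := (Localization.monoidOf (Submonoid.powers g)).map_zero }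
  have hφ : Submonoid.IsLocalizationMap (Submonoid.powers g) φ :=
    (Localization.monoidOf (Submonoid.powers g)).isLocalizationMap
  have := specMap_isOpenImmersion hφ
  refine ⟨MonZero.of (Localization (Submonoid.powers g)), specMap φ ≫ f, inferInstance, ?_⟩
  have h1 := congrArg (fun S : Set (PrimeIdeal A) => f.base '' S) (range_comap hφ)
  exact ((Set.range_comp f.base (PrimeIdeal.comap φ)).trans h1).trans hU

/-- An affine open subset is empty, or has a point whose only open neighbourhood in it is itself. -/
theorem eq_empty_or {U : Opens X} (h : IsAffine0 X U) :
    (∀ x, x ∉ U) ∨ ∃ x ∈ U, ∀ V : Opens X, x ∈ V → U ≤ V := by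
  obtain ⟨A, f, hf, hU⟩ := h
  by_cases h1 : ∀ n : ℕ, (1 : A) ^ n ≠ 0
  · obtain ⟨p, hp⟩ := exists_closedPoint (1 : A) h1
    refine Or.inr ⟨f.base p, ?_, ?_⟩
    · change f.base p ∈ (U : Set X)
      rw [← hU]
      exact ⟨p, rfl⟩
    · intro V hV x hx
      change x ∈ (U : Set X) at hx
      rw [← hU] at hx
      obtain ⟨q, rfl⟩ := hx
      exact basicOpen_le_of_closedPoint hp (U := (Opens.map f.base).obj V) hV
        (PrimeIdeal.one_notMem q)
  · push Not at h1
    obtain ⟨n, hn⟩ := h1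
    refine Or.inl fun x hx => ?_
    change x ∈ (U : Set X) at hx
    rw [← hU] at hx
    obtain ⟨q, rfl⟩ := hx
    exact basicOpen_eq_bot hn q (PrimeIdeal.one_notMem q)

theorem isPreconnected {U : Opens X} (h : IsAffine0 X U) : IsPreconnected (U : Set X) := by
  rcases h.eq_empty_or with h | ⟨x, hx, h⟩
  · rw [Set.eq_empty_of_forall_notMem h]
    exact isPreconnected_empty
  · intro V W hV hW hUVW hUV hUW
    rcases hUVW hx with hxV | hxW
    · obtain ⟨y, hyU, hyW⟩ := hUW
      exact ⟨y, hyU, h ⟨V, hV⟩ hxV hyU, hyW⟩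
    · obtain ⟨y, hyU, hyV⟩ := hUV
      exact ⟨y, hyU, hyV, h ⟨W, hW⟩ hxW hyU⟩

theorem exists_preimage_eq {A : MonZero.{u}} (f : Spec0 A ⟶ X)
    [hf : PresheafedSpace.IsOpenImmersion f] {U : Opens X} (h : IsAffine0 X U)
    (hU : (U : Set X) ⊆ Set.range f.base) :
    ∃ g : A, (Opens.map f.base).obj U = PrimeIdeal.basicOpen g := by
  rcases h.eq_empty_or with h | ⟨x, hx, h⟩
  · refine ⟨0, ?_⟩
    ext p
    exact ⟨fun hp => absurd hp (h _), fun hp => absurd p.zero_mem hp⟩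
  · obtain ⟨p, rfl⟩ := hU hx
    obtain ⟨g, hg, hgU⟩ := PrimeIdeal.exists_basicOpen (U := (Opens.map f.base).obj U) (p := p) hx
    refine ⟨g, le_antisymm (fun q hq => ?_) hgU⟩
    obtain ⟨q', hq', hqq⟩ := h (hf.base_open.functor.obj (PrimeIdeal.basicOpen g)) ⟨p, hg, rfl⟩ hq
    rw [← hf.base_open.injective hqq]
    exact hq'

theorem isIso_app {A : MonZero.{u}} (f : Spec0 A ⟶ X)
    [hf : PresheafedSpace.IsOpenImmersion f] {U : Opens X}
    (hU : (U : Set X) ⊆ Set.range f.base) : IsIso (f.c.app (op U)) := by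
  apply PresheafedSpace.IsOpenImmersion.c_iso' f ((Opens.map f.base).obj U)
  ext x
  constructor
  · intro hx
    obtain ⟨p, rfl⟩ := hU hx
    exact ⟨p, hx, rfl⟩
  · rintro ⟨p, hp, rfl⟩
    exact hp

/-- Inside an affine open subset `V = Spec A`, an open subset `U = D(g)` has sections `A_g`. -/
theorem exists_isLocAway {A : MonZero.{u}} (f : Spec0 A ⟶ X)
    [hf : PresheafedSpace.IsOpenImmersion f] {V : Opens X} (hV : Set.range f.base = (V : Set X)) :
    ∃ j : A →*₀ X.presheaf.obj (op V), ∀ (U : Opens X) (i : U ⟶ V) (g : A),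
      (Opens.map f.base).obj U = PrimeIdeal.basicOpen g →
      IsLocAway (MonZero.hom (X.presheaf.map i.op)) (j g) := by
  have hi1 : IsIso (f.c.app (op V)) := isIso_app f hV.ge
  have htop : (Opens.map f.base).obj V = ⊤ := by
    refine top_le_iff.1 fun p _ => ?_
    change f.base p ∈ (V : Set X)
    rw [← hV]
    exact ⟨p, rfl⟩
  let e : SpecSec (A := A) ((Opens.map f.base).obj V : Opens (specTop A)) →*₀
    X.presheaf.obj (op V) := MonZero.hom (inv (f.c.app (op V)))
  refine ⟨e.comp (toSec _), fun U i g hg => ?_⟩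
  have hU' : (U : Set X) ⊆ Set.range f.base := hV ▸ i.le
  have hi2 : IsIso (f.c.app (op U)) := isIso_app f hU'
  let e' : SpecSec (A := A) ((Opens.map f.base).obj U : Opens (specTop A)) →*₀
    X.presheaf.obj (op U) := MonZero.hom (inv (f.c.app (op U)))
  refine IsLocAway.of_equiv
    (res_isLocAway ((Opens.map f.base).map i).le htop g hg) _ e e'
    (MonZero.bijective_of_isIso (inv (f.c.app (op V))))
    (MonZero.bijective_of_isIso (inv (f.c.app (op U)))) ?_
  intro x
  have hnat : inv (f.c.app (op V)) ≫ X.presheaf.map i.op =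
      (Spec0 A).presheaf.map ((Opens.map f.base).map i).op ≫ inv (f.c.app (op U)) := by
    rw [IsIso.inv_comp_eq, ← Category.assoc, IsIso.eq_comp_inv]
    exact f.c.naturality i.op
  exact congrArg (fun h => MonZero.hom h x) hnat

end IsAffine0

namespace M0Scheme

variable (X : M0Scheme.{u})

/-! #### Stalks -/

/-- The restriction maps `𝒪(U) → 𝒪(V)` for open neighbourhoods `V ⊆ U` of `x`. -/
def germRes (x : X.carrier) (U V : (OpenNhds x)ᵒᵈ) (h : U ≤ V) :
    X.presheaf.obj (op (OrderDual.ofDual U).1) →*₀ X.presheaf.obj (op (OrderDual.ofDual V).1) :=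
  MonZero.hom (X.presheaf.map
    (homOfLE (show (OrderDual.ofDual V).1 ≤ (OrderDual.ofDual U).1 from h)).op)

instance (x : X.carrier) : DirectedSystem
    (fun U : (OpenNhds x)ᵒᵈ => X.presheaf.obj (op (OrderDual.ofDual U).1))
    (fun U V h => X.germRes x U V h) where
  map_self U a := by
    have h := X.presheaf.map_id (op (OrderDual.ofDual U).1)
    exact congrArg (fun f => MonZero.hom f a) h
  map_map {W V U} hUV hVW a := by
    have h := X.presheaf.map_comp (homOfLE (show (OrderDual.ofDual V).1 ≤ (OrderDual.ofDual U).1 from hUV)).op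
      (homOfLE (show (OrderDual.ofDual W).1 ≤ (OrderDual.ofDual V).1 from hVW)).op
    exact congrArg (fun f => MonZero.hom f a) h.symm

/-- The stalk `𝒪_{X,x}`: the direct limit of `𝒪(U)` over the open neighbourhoods `U` of `x`. -/
def stalk (x : X.carrier) : Type u :=
  DirectLimit (fun U : (OpenNhds x)ᵒᵈ => X.presheaf.obj (op (OrderDual.ofDual U).1)) (X.germRes x)

instance (x : X.carrier) : CommMonoidWithZero (X.stalk x) :=
  inferInstanceAs (CommMonoidWithZero (DirectLimit
    (fun U : (OpenNhds x)ᵒᵈ => X.presheaf.obj (op (OrderDual.ofDual U).1)) (X.germRes x)))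

/-- An `𝓜₀`-scheme is integral if its stalks are: non-zero elements can be cancelled, i.e. the map
from the stalk to its localization at the non-zero elements is injective. -/
def IsIntegral : Prop := ∀ x, IsCancelMulZero (X.stalk x)

/-- An `𝓜₀`-scheme is torsion-free if its stalks are multiplicatively torsion-free: `a ^ n = b ^ n`
with `n ≠ 0` implies `a = b`. -/
def IsTorsionFree : Prop := ∀ x, IsMulTorsionFree (X.stalk x)

/-- The unit groups of all stalks are finitely generated. -/
def HasFGUnits : Prop := ∀ x, Group.FG (X.stalk x)ˣ

/-! #### Connected components -/

theorem isOpen_connectedComponent (x : X.carrier) : IsOpen (connectedComponent x) := by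
  rw [isOpen_iff_forall_mem_open]
  intro y hy
  obtain ⟨U, hyU, hU⟩ := X.exists_affine y
  refine ⟨U, ?_, U.2, hyU⟩
  rw [connectedComponent_eq hy]
  exact hU.isPreconnected.subset_connectedComponent hyU

/-- The connected component of `x`, an open subset. -/
def component (x : X.carrier) : Opens X.carrier :=
  ⟨connectedComponent x, X.isOpen_connectedComponent x⟩

end M0Scheme

/-! ### Base extension to `ℤ` -/

/-- The ring `ℤ[A] / (1 · 0_A)`: the monoid ring of `A` in which the zero of `A` is identified with
the zero of the ring. -/
abbrev Z0 (A : Type u) [CommMonoidWithZero A] : Type u :=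
  MonoidAlgebra ℤ A ⧸ Ideal.span {(MonoidAlgebra.single (0 : A) (1 : ℤ) : MonoidAlgebra ℤ A)}

namespace Z0

variable {A B : Type u} [CommMonoidWithZero A] [CommMonoidWithZero B]

variable (A) in
/-- The canonical multiplicative map `A → ℤ[A] / (1 · 0_A)`. -/
def of : A →*₀ Z0 A where
  toFun a := Ideal.Quotient.mk _ (MonoidAlgebra.of ℤ A a)
  map_zero' := Ideal.Quotient.eq_zero_iff_mem.2 (Ideal.subset_span rfl)
  map_one' := by rw [map_one, map_one]
  map_mul' a b := by rw [map_mul, map_mul]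

/-- The ring homomorphism induced by a map of monoids with zero. -/
def map (f : A →*₀ B) : Z0 A →+* Z0 B :=
  Ideal.Quotient.lift _
    ((Ideal.Quotient.mk _).comp (MonoidAlgebra.mapDomainRingHom ℤ (f : A →* B))) (by
      intro x hx
      have hle : Ideal.span {(MonoidAlgebra.single (0 : A) (1 : ℤ) : MonoidAlgebra ℤ A)} ≤
          RingHom.ker ((Ideal.Quotient.mk (Ideal.span
            {(MonoidAlgebra.single (0 : B) (1 : ℤ) : MonoidAlgebra ℤ B)})).comp
              (MonoidAlgebra.mapDomainRingHom ℤ (f : A →* B))) := by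
        rw [Ideal.span_le, Set.singleton_subset_iff, SetLike.mem_coe, RingHom.mem_ker]
        refine Eq.trans ?_ (map_zero (of B))
        rw [RingHom.comp_apply]
        change _ = Ideal.Quotient.mk _ (MonoidAlgebra.single (0 : B) (1 : ℤ))
        simp
      exact RingHom.mem_ker.1 (hle hx))

theorem map_of (f : A →*₀ B) (a : A) : map f (of A a) = of B (f a) := by
  change Ideal.Quotient.lift _ _ _ (Ideal.Quotient.mk _ _) = Ideal.Quotient.mk _ _
  rw [Ideal.Quotient.lift_mk]
  simp

theorem hom_ext {R : Type*} [CommRing R] {f g : Z0 A →+* R} (h : ∀ a, f (of A a) = g (of A a)) :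
    f = g := by
  apply Ideal.Quotient.ringHom_ext
  apply MonoidAlgebra.ringHom_ext
  · intro n
    have : (MonoidAlgebra.single (1 : A) n : MonoidAlgebra ℤ A) = (n : MonoidAlgebra ℤ A) := by
      simp [MonoidAlgebra.intCast_def]
    rw [this, map_intCast, map_intCast]
  · exact h

/-- The universal property of `ℤ[A] / (1 · 0_A)`. -/
def lift {R : Type*} [CommRing R] (f : A →*₀ R) : Z0 A →+* R :=
  Ideal.Quotient.lift _ (MonoidAlgebra.lift ℤ R A (f : A →* R)).toRingHom (by
    intro x hx
    have hle : Ideal.span {(MonoidAlgebra.single (0 : A) (1 : ℤ) : MonoidAlgebra ℤ A)} ≤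
        RingHom.ker (MonoidAlgebra.lift ℤ R A (f : A →* R)).toRingHom := by
      rw [Ideal.span_le, Set.singleton_subset_iff, SetLike.mem_coe, RingHom.mem_ker]
      simp
    exact RingHom.mem_ker.1 (hle hx))

theorem lift_of {R : Type*} [CommRing R] (f : A →*₀ R) (a : A) : lift f (of A a) = f a := by
  change Ideal.Quotient.lift _ _ _ (Ideal.Quotient.mk _ _) = _
  rw [Ideal.Quotient.lift_mk]
  simp

theorem isLocalization (f : A →*₀ B) (g : A) (h : IsLocAway f g) :
    letI := (map f).toAlgebra
    IsLocalization.Away (of A g) (Z0 B) := by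
  let _ := (map f).toAlgebra
  let R := Localization.Away (of A g)
  let ψ : A →*₀ R := ((algebraMap (Z0 A) R).toMonoidWithZeroHom).comp (of A)
  have hψ : ∀ y : Submonoid.powers g, IsUnit (ψ y) := by
    rintro ⟨_, n, rfl⟩
    change IsUnit (ψ (g ^ n))
    rw [map_pow]
    exact (IsLocalization.Away.algebraMap_isUnit (of A g)).pow n
  let F : Submonoid.LocalizationMap (Submonoid.powers g) B := ⟨(f : A →ₙ* B), h⟩
  let χ : B →*₀ R := F.lift₀ ψ hψ
  have hχ : ∀ a, χ (f a) = ψ a := fun a => F.lift_eq hψ a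
  have hu : IsUnit (algebraMap (Z0 A) (Z0 B) (of A g)) := by
    change IsUnit (map f (of A g))
    rw [map_of]
    exact (h.map_units ⟨g, 1, pow_one g⟩).map (of B)
  let a : R →+* Z0 B := IsLocalization.Away.lift (of A g) hu
  let b : Z0 B →+* R := lift χ
  have hab : a.comp b = RingHom.id _ := by
    apply hom_ext
    intro z
    obtain ⟨⟨x, s⟩, hs⟩ := h.surj z
    dsimp only at hs
    have hsu : IsUnit (of B (f s)) := (h.map_units s).map (of B)
    apply hsu.mul_right_cancel
    have key : ∀ y : A, a (b (of B (f y))) = of B (f y) := by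
      intro y
      change IsLocalization.Away.lift (of A g) hu (lift χ (of B (f y))) = _
      rw [lift_of, hχ]
      change IsLocalization.Away.lift (of A g) hu (algebraMap (Z0 A) R (of A y)) = _
      rw [IsLocalization.Away.lift_eq]
      exact map_of f y
    calc a (b (of B z)) * of B (f s) = a (b (of B z)) * a (b (of B (f s))) := by rw [key]
      _ = a (b (of B (z * f s))) := by rw [map_mul (of B), map_mul b, map_mul a]
      _ = of B (z * f s) := by rw [hs, key]
      _ = of B z * of B (f s) := map_mul _ _ _
  have hba : b.comp a = RingHom.id _ := by
    apply IsLocalization.ringHom_ext (Submonoid.powers (of A g))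
    apply hom_ext
    intro x
    change lift χ (IsLocalization.Away.lift (of A g) hu (algebraMap (Z0 A) R (of A x))) =
      algebraMap (Z0 A) R (of A x)
    rw [IsLocalization.Away.lift_eq]
    change lift χ (map f (of A x)) = _
    rw [map_of, lift_of, hχ]
    rfl
  let e : R ≃ₐ[Z0 A] Z0 B := AlgEquiv.ofRingEquiv (f := RingEquiv.ofRingHom a b hab hba)
    (fun x => IsLocalization.Away.lift_eq (of A g) hu x)
  exact IsLocalization.isLocalization_of_algEquiv (Submonoid.powers (of A g)) e

end Z0

/-- The functor `A ↦ ℤ[A] / (1 · 0_A)` from monoids with zero to rings. -/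
def z0Functor : MonZero.{u} ⥤ CommRingCat.{u} where
  obj A := CommRingCat.of (Z0 A)
  map f := CommRingCat.ofHom (Z0.map (MonZero.hom f))
  map_id A := by
    apply CommRingCat.hom_ext
    apply Z0.hom_ext
    intro a
    exact Z0.map_of (MonoidWithZeroHom.id A) a
  map_comp f g := by
    apply CommRingCat.hom_ext
    apply Z0.hom_ext
    intro a
    change Z0.map ((MonZero.hom g).comp (MonZero.hom f)) (Z0.of _ a) =
      Z0.map (MonZero.hom g) (Z0.map (MonZero.hom f) (Z0.of _ a))
    rw [Z0.map_of, Z0.map_of, Z0.map_of]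
    rfl

theorem isOpenImmersion_of_isLocAway {M N : MonZero.{u}} (f : M ⟶ N) (g : M)
    (h : IsLocAway (MonZero.hom f) g) :
    IsOpenImmersion (Spec.map (z0Functor.map f)) ∧
      Set.range (Spec.map (z0Functor.map f)) =
        (PrimeSpectrum.basicOpen (Z0.of M g) : Set (PrimeSpectrum (Z0 M))) := by
  have h1 := Z0.isLocalization _ g h
  let _ := (Z0.map (MonZero.hom f)).toAlgebra
  constructor
  · exact IsOpenImmersion.of_isLocalization (R := CommRingCat.of (Z0 M))
      (S := Z0 N) (Z0.of M g)
  · exact PrimeSpectrum.localization_away_comap_range (Z0 N) (Z0.of M g)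

namespace M0Scheme

variable (X : M0Scheme.{u})

/-- The affine open subsets, ordered by inclusion. -/
abbrev AffineOpens : Type u := {U : Opens X.carrier // IsAffine0 X.toPresheafedSpace U}

/-- The diagram of schemes `U ↦ Spec (ℤ[𝒪(U)] / (1 · 0))` over the affine open subsets. -/
def diagram : X.AffineOpens ⥤ Scheme.{u} :=
  (((Subtype.mono_coe _).functor : X.AffineOpens ⥤ Opens X.carrier).op ⋙
    X.presheaf ⋙ z0Functor).rightOp ⋙ Scheme.Spec

instance {U V : X.AffineOpens} (i : U ⟶ V) : IsOpenImmersion (X.diagram.map i) := by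
  obtain ⟨A, f, hf, hV⟩ := V.2
  have hU : (U.1 : Set X.carrier) ⊆ Set.range f.base := hV ▸ leOfHom i
  obtain ⟨g, hg⟩ := IsAffine0.exists_preimage_eq f U.2 hU
  obtain ⟨j, hj⟩ := IsAffine0.exists_isLocAway f hV
  exact (isOpenImmersion_of_isLocAway _ _ (hj U.1 (homOfLE (leOfHom i)) g hg)).1

instance : (X.diagram ⋙ Scheme.forget).IsLocallyDirected where
  cond := by
    intro U₁ U₂ V i₁ i₂ x₁ x₂ hx
    obtain ⟨A, f, hf, hV⟩ := V.2
    have hU₁ : (U₁.1 : Set X.carrier) ⊆ Set.range f.base := hV ▸ leOfHom i₁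
    have hU₂ : (U₂.1 : Set X.carrier) ⊆ Set.range f.base := hV ▸ leOfHom i₂
    obtain ⟨g₁, hg₁⟩ := IsAffine0.exists_preimage_eq f U₁.2 hU₁
    obtain ⟨g₂, hg₂⟩ := IsAffine0.exists_preimage_eq f U₂.2 hU₂
    have hpre : (Opens.map f.base).obj (U₁.1 ⊓ U₂.1) = PrimeIdeal.basicOpen (g₁ * g₂) := by
      change (Opens.map f.base).obj U₁.1 ⊓ (Opens.map f.base).obj U₂.1 = _
      rw [hg₁, hg₂]
      ext p
      exact ⟨fun h => p.compl.mul_mem h.1 h.2,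
        fun h => ⟨fun h1 => h (p.mul_mem _ _ h1), fun h2 => h (p.mul_mem_right _ h2)⟩⟩
    have haff : IsAffine0 X.toPresheafedSpace (U₁.1 ⊓ U₂.1) := by
      apply IsAffine0.basicOpen f (g₁ * g₂)
      rw [← hpre]
      exact Set.image_preimage_eq_of_subset (f := f.base)
        (s := ((U₁.1 ⊓ U₂.1 : Opens X.carrier) : Set X.carrier)) (fun x hx => hU₁ hx.1)
    let W : X.AffineOpens := ⟨U₁.1 ⊓ U₂.1, haff⟩
    let k₁ : W ⟶ U₁ := homOfLE (show U₁.1 ⊓ U₂.1 ≤ U₁.1 from inf_le_left)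
    let k₂ : W ⟶ U₂ := homOfLE (show U₁.1 ⊓ U₂.1 ≤ U₂.1 from inf_le_right)
    obtain ⟨j, hj⟩ := IsAffine0.exists_isLocAway f hV
    have r₁ := (isOpenImmersion_of_isLocAway _ _ (hj U₁.1 (homOfLE (leOfHom i₁)) g₁ hg₁)).2
    have r₂ := (isOpenImmersion_of_isLocAway _ _ (hj U₂.1 (homOfLE (leOfHom i₂)) g₂ hg₂)).2
    have r := (isOpenImmersion_of_isLocAway _ _
      (hj W.1 (homOfLE (leOfHom (k₁ ≫ i₁))) (g₁ * g₂) hpre)).2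
    replace r₁ : Set.range (X.diagram.map i₁) = _ := r₁
    replace r₂ : Set.range (X.diagram.map i₂) = _ := r₂
    replace r : Set.range (X.diagram.map (k₁ ≫ i₁)) = _ := r
    replace hx : X.diagram.map i₁ x₁ = X.diagram.map i₂ x₂ := hx
    have hz : X.diagram.map i₁ x₁ ∈ Set.range (X.diagram.map (k₁ ≫ i₁)) := by
      have h1 : X.diagram.map i₁ x₁ ∈ Set.range (X.diagram.map i₁) := ⟨x₁, rfl⟩
      have h2 : X.diagram.map i₁ x₁ ∈ Set.range (X.diagram.map i₂) := ⟨x₂, hx.symm⟩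
      rw [r₁] at h1
      rw [r₂] at h2
      rw [r, map_mul, map_mul, PrimeSpectrum.basicOpen_mul]
      exact ⟨h1, h2⟩
    obtain ⟨y, hy⟩ := hz
    refine ⟨W, k₁, k₂, y, ?_, ?_⟩
    · apply (X.diagram.map i₁).isOpenEmbedding.injective
      rw [← hy, X.diagram.map_comp]
      rfl
    · apply (X.diagram.map i₂).isOpenEmbedding.injective
      rw [← hx, ← hy, show k₁ ≫ i₁ = k₂ ≫ i₂ from Subsingleton.elim _ _, X.diagram.map_comp]
      rfl

instance : HasColimit X.diagram := inferInstance

/-- The base extension `X_ℤ`, glued from the affine schemes `Spec (ℤ[𝒪(U)] / (1 · 0))`, where `U`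
runs through the affine open subsets of `X`. -/
def baseExt : Scheme.{u} := colimit X.diagram

/-- The open subscheme `Spec (ℤ[𝒪(U)] / (1 · 0))` of `X_ℤ` for an affine open subset `U`. -/
def chart (U : X.AffineOpens) :
    Spec (CommRingCat.of (Z0 (X.presheaf.obj (op U.1)))) ⟶ X.baseExt :=
  colimit.ι X.diagram U

instance (U : X.AffineOpens) : IsOpenImmersion (X.chart U) :=
  inferInstanceAs (IsOpenImmersion (colimit.ι X.diagram U))

/-- For an open subset `W` of `X`, the open subscheme `W_ℤ` of `X_ℤ`: the union of the charts of the
affine open subsets of `W`. -/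
def baseExtOpen (W : Opens X.carrier) : X.baseExt.Opens :=
  ⨆ U : {U : X.AffineOpens // U.1 ≤ W}, (X.chart U.1).opensRange

end M0Scheme

/-! ### CC-schemes and torifications -/

/-- A CC-scheme: an `𝓜₀`-scheme, a scheme `X`, and an evaluation map `e : X̃_ℤ → X` that is bijective
on `k`-valued points for every field `k`. (By Yoneda, natural transformations between the functors of
points on rings are the same as morphisms of schemes.) -/
structure CCScheme where
  tilde : M0Scheme.{u}
  X : Scheme.{u}
  e : tilde.baseExt ⟶ X
  bijective_points : ∀ (k : Type u) [Field k],
    Function.Bijective fun x : Spec (CommRingCat.of k) ⟶ tilde.baseExt => x ≫ e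

/-- The restriction of `e` to the open subscheme `Ỹ_ℤ`, where `Ỹ` is the connected component of the
point `x`. -/
def CCScheme.eComponent (𝒳 : CCScheme.{u}) (x : 𝒳.tilde.carrier) :
    (𝒳.tilde.baseExtOpen (𝒳.tilde.component x)).toScheme ⟶ 𝒳.X :=
  (𝒳.tilde.baseExtOpen (𝒳.tilde.component x)).ι ≫ 𝒳.e

/-- The split torus `𝔾ₘ^d = Spec ℤ[ℤ^d]` over `ℤ`. -/
def splitTorus (d : ℕ) : Scheme.{u} :=
  Spec (CommRingCat.of (AddMonoidAlgebra (ULift.{u} ℤ) (Fin d → ℤ)))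

/-- A torification of a scheme `X`: a morphism `e : T → X` from a disjoint union `T` of split tori
such that the restriction of `e` to each of the tori is an immersion and `e` is bijective on
`k`-valued points for every field `k`. -/
structure Torification (X : Scheme.{u}) where
  ι : Type u
  d : ι → ℕ
  e : (∐ fun i => splitTorus.{u} (d i)) ⟶ X
  isImmersion : ∀ i, IsImmersion (Sigma.ι (fun i => splitTorus.{u} (d i)) i ≫ e)
  bijective_points : ∀ (k : Type u) [Field k], Function.Bijective
    fun x : Spec (CommRingCat.of k) ⟶ ∐ fun i => splitTorus.{u} (d i) => x ≫ e

/-- A scheme is torified if it admits a torification. -/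
def IsTorified (X : Scheme.{u}) : Prop := Nonempty (Torification X)

end F1

end

noncomputable section

namespace F1

/-! The tori are indexed by the points of `X̃`. Integrality and finite generation of units give
every point `x` a smallest open neighbourhood `U_x`, and it is affine (`exists_minimal_affine`):
finitely many generators of the units of the stalk lift to units on a single affine `V`. A smaller
basic neighbourhood `D(a)` of `x` makes `a` a unit in the stalk, so `a` agrees near `x` with a unit
of `𝒪(V)`; cancellation turns this into equality on `V`, whence `D(a) = V`.

Consequently `𝒪(U_x)` is the stalk at `x`, and its units, being finitely generated and torsion-free,
form a group `ℤ^d`. Killing the non-units of `𝒪(U_x)` maps `ℤ[𝒪(U_x)]/(1·0)` onto the group ring of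
the units, so `𝔾ₘ^d` is a closed subscheme `T_x` of the chart of `U_x`.

Every point of `X̃_ℤ` with values in a field `k` lies on exactly one `T_x`. For existence
(`exists_factor_minimal`), a homomorphism `𝒪(U) → k` has a prime zero set; this is a point `x`, and
the homomorphism extends to the localization `𝒪(U_x)`, where it vanishes exactly on the non-units.
For uniqueness (`eq_of_comp_torusMap_eq`), a `k`-point that kills the non-units of `𝒪(U)` lies in no
smaller chart. Hence `∐ T_x → X̃_ℤ` is bijective on `k`-points, and so is its composite with `e_X`.

Finally, affine opens are connected, so the chart of `U_x` is an open subscheme of `Ỹ_ℤ` for the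
component `Ỹ` of `x`; thus `T_x → X` is a closed immersion, an open immersion and an immersion in
succession. -/

/-! ### Affine open subsets in terms of their own sections. -/

/-- Restriction of sections, as a map of monoids with zero. -/
def resHom (X : PresheafedSpace MonZero.{u}) {U V : Opens X} (h : U ≤ V) :
    X.presheaf.obj (op V) →*₀ X.presheaf.obj (op U) :=
  MonZero.hom (X.presheaf.map (homOfLE h).op)

theorem resHom_resHom (X : PresheafedSpace MonZero.{u}) {U V W : Opens X} (h : U ≤ V)
    (h' : V ≤ W) (s : X.presheaf.obj (op W)) :
    resHom X h (resHom X h' s) = resHom X (h.trans h') s :=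
  (congrArg (fun f => MonZero.hom f s)
    (X.presheaf.map_comp (homOfLE h').op (homOfLE h).op)).symm

theorem resHom_rfl (X : PresheafedSpace MonZero.{u}) {U : Opens X}
    (s : X.presheaf.obj (op U)) : resHom X (le_refl U) s = s :=
  congrArg (fun f => MonZero.hom f s) (X.presheaf.map_id (op U))

/-- An identification of an open subset `V` with the spectrum of its monoid of sections. -/
structure AffineCoord (X : PresheafedSpace MonZero.{u}) (V : Opens X) where
  pt : PrimeIdeal (X.presheaf.obj (op V)) → X
  pt_injective : Function.Injective pt
  range_pt : Set.range pt = (V : Set X)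
  D : X.presheaf.obj (op V) → Opens X
  D_le : ∀ a, D a ≤ V
  pt_mem_D : ∀ a p, pt p ∈ D a ↔ a ∉ p
  isAffine0_D : ∀ a, IsAffine0 X (D a)
  exists_mem_D_le : ∀ (W : Opens X), W ≤ V → ∀ x ∈ W, ∃ a, x ∈ D a ∧ D a ≤ W
  isLocAway : ∀ a, IsLocAway (resHom X (D_le a)) a

theorem PrimeIdeal.comap_bijective {A B : Type u} [CommMonoidWithZero A] [CommMonoidWithZero B]
    {φ : A →*₀ B} (hφ : Function.Bijective φ) : Function.Bijective (PrimeIdeal.comap φ) := by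
  constructor
  · intro p q h
    ext b
    obtain ⟨a, rfl⟩ := hφ.2 b
    exact (iff_of_eq (congrArg (fun r => a ∈ r) h) : a ∈ p.comap φ ↔ a ∈ q.comap φ)
  · intro p
    let e : A ≃* B := MulEquiv.ofBijective φ hφ
    let ψ : B →*₀ A := { e.symm.toMonoidHom with map_zero' := map_zero e.symm }
    refine ⟨p.comap ψ, ?_⟩
    ext a
    change ψ (φ a) ∈ p ↔ a ∈ p
    rw [show ψ (φ a) = a from e.symm_apply_apply a]

/-- An isomorphism `Spec A ≅ V` induces `j : A ≃ 𝒪(V)`. Transporting primes, basic opens and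
localizations along `j` eliminates the auxiliary monoid `A`, so that later arguments speak of
elements of `𝒪(V)` only. -/
theorem IsAffine0.nonempty_affineCoord {X : PresheafedSpace MonZero.{u}} {V : Opens X}
    (h : IsAffine0 X V) : Nonempty (AffineCoord X V) := by
  obtain ⟨A, f, hf, hV⟩ := h
  have hi1 : IsIso (f.c.app (op V)) := isIso_app f hV.ge
  have htop : (Opens.map f.base).obj V = ⊤ := by
    refine top_le_iff.1 fun p _ => ?_
    change f.base p ∈ (V : Set X)
    rw [← hV]
    exact ⟨p, rfl⟩
  have hsec : Function.Bijective
      (toSec ((Opens.map f.base).obj V : Opens (specTop A))) := by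
    rw [htop]
    exact toSec_top_bijective
  let e : SpecSec (A := A) ((Opens.map f.base).obj V : Opens (specTop A)) →*₀
    X.presheaf.obj (op V) := MonZero.hom (inv (f.c.app (op V)))
  let j : A →*₀ X.presheaf.obj (op V) := e.comp (toSec _)
  have hj : Function.Bijective j :=
    (MonZero.bijective_of_isIso (inv (f.c.app (op V)))).comp hsec
  -- `g` is the inverse of the bijection `j`, used only as a function.
  choose g hg using hj.2
  let D : X.presheaf.obj (op V) → Opens X := fun a =>
    hf.base_open.functor.obj (PrimeIdeal.basicOpen (g a))
  have hD : ∀ a, D a ≤ V := by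
    rintro a _ ⟨p, _, rfl⟩
    change f.base p ∈ (V : Set X)
    rw [← hV]
    exact ⟨p, rfl⟩
  have hpre : ∀ a, (Opens.map f.base).obj (D a) = PrimeIdeal.basicOpen (g a) := by
    intro a
    apply Opens.ext
    exact Set.preimage_image_eq _ hf.base_open.injective
  have hrange : Set.range (fun p => f.base (PrimeIdeal.comap j p)) = (V : Set X) := by
    rw [← hV]
    exact (PrimeIdeal.comap_bijective hj).2.range_comp f.base
  refine ⟨⟨fun p => f.base (p.comap j),
    hf.base_open.injective.comp (PrimeIdeal.comap_bijective hj).1, hrange, D, hD, ?_, ?_, ?_, ?_⟩⟩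
  · intro a p
    change p.comap j ∈ (Opens.map f.base).obj (D a) ↔ _
    rw [hpre, PrimeIdeal.mem_basicOpen, PrimeIdeal.mem_comap, hg]
  · intro a
    exact IsAffine0.basicOpen f (g a) _ rfl
  · intro W hW x hx
    have hxV : x ∈ (V : Set X) := hW hx
    rw [← hV] at hxV
    obtain ⟨p, rfl⟩ := hxV
    obtain ⟨b, hb, hbW⟩ := PrimeIdeal.exists_basicOpen (U := (Opens.map f.base).obj W) (p := p) hx
    have hb' : g (j b) = b := hj.1 (hg _)
    refine ⟨j b, ?_, ?_⟩
    · refine ⟨p, ?_, rfl⟩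
      rw [hb']
      exact hb
    · rintro _ ⟨q, hq, rfl⟩
      rw [hb'] at hq
      exact hbW hq
  · intro a
    have hU' : (D a : Set X) ⊆ Set.range f.base := hV ▸ hD a
    have hi2 : IsIso (f.c.app (op (D a))) := isIso_app f hU'
    let e' : SpecSec (A := A) ((Opens.map f.base).obj (D a) : Opens (specTop A)) →*₀
      X.presheaf.obj (op (D a)) := MonZero.hom (inv (f.c.app (op (D a))))
    have key := IsLocAway.of_equiv
      (res_isLocAway ((Opens.map f.base).map (homOfLE (hD a))).le htop (g a) (hpre a))
      (resHom X (hD a)) e e'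
      (MonZero.bijective_of_isIso (inv (f.c.app (op V))))
      (MonZero.bijective_of_isIso (inv (f.c.app (op (D a))))) (by
        intro x
        have hnat : inv (f.c.app (op V)) ≫ X.presheaf.map (homOfLE (hD a)).op =
            (Spec0 A).presheaf.map ((Opens.map f.base).map (homOfLE (hD a))).op ≫
              inv (f.c.app (op (D a))) := by
          rw [IsIso.inv_comp_eq, ← Category.assoc, IsIso.eq_comp_inv]
          exact f.c.naturality (homOfLE (hD a)).op
        exact congrArg (fun h => MonZero.hom h x) hnat)
    have hja : e (toSec _ (g a)) = a := hg a
    rwa [hja] at key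

/-! ### Germs, and the existence of smallest neighbourhoods. -/

namespace M0Scheme

variable (X : M0Scheme.{u})

/-- The germ at `x` of a section. -/
def germ (x : X.carrier) {U : Opens X.carrier} (hx : x ∈ U) :
    X.presheaf.obj (op U) →*₀ X.stalk x where
  toFun s := Quotient.mk _ ⟨OrderDual.toDual ⟨U, hx⟩, s⟩
  map_zero' := (DirectLimit.zero_def (f := X.germRes x) (OrderDual.toDual ⟨U, hx⟩)).symm
  map_one' := (DirectLimit.one_def (f := X.germRes x) (OrderDual.toDual ⟨U, hx⟩)).symm
  map_mul' s t := (DirectLimit.mul_def (f := X.germRes x) (OrderDual.toDual ⟨U, hx⟩) s t).symm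

variable {X}

theorem germ_eq_iff {x : X.carrier} {U V : Opens X.carrier} (hU : x ∈ U) (hV : x ∈ V)
    (s : X.presheaf.obj (op U)) (t : X.presheaf.obj (op V)) :
    X.germ x hU s = X.germ x hV t ↔ ∃ (W : Opens X.carrier) (_ : x ∈ W) (h : W ≤ U) (h' : W ≤ V),
      resHom X.toPresheafedSpace h s = resHom X.toPresheafedSpace h' t := by
  refine Quotient.eq.trans ?_
  constructor
  · rintro ⟨W, h, h', e⟩
    exact ⟨(OrderDual.ofDual W).1, (OrderDual.ofDual W).2, h, h', e⟩
  · rintro ⟨W, hW, h, h', e⟩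
    exact ⟨OrderDual.toDual ⟨W, hW⟩, h, h', e⟩

theorem germ_resHom {x : X.carrier} {U V : Opens X.carrier} (h : U ≤ V) (hU : x ∈ U)
    (s : X.presheaf.obj (op V)) :
    X.germ x hU (resHom X.toPresheafedSpace h s) = X.germ x (h hU) s :=
  (germ_eq_iff _ _ _ _).2 ⟨U, hU, le_rfl, h, resHom_rfl _ _⟩

theorem exists_germ_eq {x : X.carrier} (z : X.stalk x) :
    ∃ (U : Opens X.carrier) (hU : x ∈ U) (s : X.presheaf.obj (op U)), X.germ x hU s = z := by
  obtain ⟨U, s, rfl⟩ := DirectLimit.exists_eq_mk _ z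
  exact ⟨(OrderDual.ofDual U).1, (OrderDual.ofDual U).2, s, rfl⟩

/-- A smallest neighbourhood is a last index of the direct system, so the limit is already attained
there. -/
theorem germ_bijective {x : X.carrier} {U : Opens X.carrier} (hx : x ∈ U)
    (hmin : ∀ W : Opens X.carrier, x ∈ W → U ≤ W) : Function.Bijective (X.germ x hx) := by
  constructor
  · intro s t hst
    obtain ⟨W, hW, h, _, e⟩ := (germ_eq_iff _ _ _ _).1 hst
    obtain rfl : W = U := le_antisymm h (hmin W hW)
    rwa [resHom_rfl, resHom_rfl] at e
  · intro z
    obtain ⟨W, hW, s, rfl⟩ := exists_germ_eq z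
    exact ⟨resHom _ (hmin W hW) s, germ_resHom _ _ _⟩

/-- Representatives of a germ and of its inverse have product `1` only near `x`; shrinking to where
this holds gives a unit section. -/
theorem exists_units_map_germ_eq {x : X.carrier} (u : (X.stalk x)ˣ) :
    ∃ (U : Opens X.carrier) (hU : x ∈ U) (v : (X.presheaf.obj (op U))ˣ),
      Units.map (X.germ x hU).toMonoidHom v = u := by
  obtain ⟨U, hU, s, hs⟩ := exists_germ_eq (u : X.stalk x)
  obtain ⟨V, hV, t, ht⟩ := exists_germ_eq ((u⁻¹ : (X.stalk x)ˣ) : X.stalk x)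
  have hUV : x ∈ U ⊓ V := ⟨hU, hV⟩
  have hmul : X.germ x hUV
      (resHom X.toPresheafedSpace inf_le_left s * resHom X.toPresheafedSpace inf_le_right t) =
      X.germ x hUV 1 := by
    rw [map_mul, germ_resHom, germ_resHom, hs, ht, map_one, Units.mul_inv]
  obtain ⟨W, hW, h, h', e⟩ := (germ_eq_iff _ _ _ _).1 hmul
  rw [map_mul, map_one, resHom_resHom, resHom_resHom] at e
  refine ⟨W, hW, Units.mkOfMulEqOne _ _ e, Units.ext ?_⟩
  exact (germ_resHom _ _ _).trans hs

theorem exists_affine_le {x : X.carrier} {U : Opens X.carrier} (hx : x ∈ U) :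
    ∃ V : Opens X.carrier, x ∈ V ∧ V ≤ U ∧ IsAffine0 X.toPresheafedSpace V := by
  obtain ⟨W, hW, haff⟩ := X.exists_affine x
  obtain ⟨c⟩ := haff.nonempty_affineCoord
  obtain ⟨a, ha, haW⟩ := c.exists_mem_D_le (W ⊓ U) inf_le_left x ⟨hW, hx⟩
  exact ⟨c.D a, ha, haW.trans inf_le_right, c.isAffine0_D a⟩

/-- Each unit germ lifts on its own neighbourhood. Finite generation is what allows one
neighbourhood for all: it suffices to lift the generators, and a finite intersection of open sets is
open. -/
theorem exists_affine_forall_units {x : X.carrier} (h : Group.FG (X.stalk x)ˣ) :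
    ∃ (V : Opens X.carrier) (hx : x ∈ V), IsAffine0 X.toPresheafedSpace V ∧
      ∀ u : (X.stalk x)ˣ, ∃ v : (X.presheaf.obj (op V))ˣ,
        Units.map (X.germ x hx).toMonoidHom v = u := by
  obtain ⟨S, hS⟩ := h.out
  have hfin : ∀ T : Finset (X.stalk x)ˣ, ∃ (V : Opens X.carrier) (hx : x ∈ V),
      ∀ u ∈ T, ∃ v : (X.presheaf.obj (op V))ˣ, Units.map (X.germ x hx).toMonoidHom v = u := by
    classical
    intro T
    induction T using Finset.induction_on with
    | empty => exact ⟨⊤, trivial, by simp⟩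
    | insert w T _ ih =>
      obtain ⟨V, hV, h⟩ := ih
      obtain ⟨W, hW, v, hv⟩ := exists_units_map_germ_eq w
      refine ⟨V ⊓ W, ⟨hV, hW⟩, fun u hu => ?_⟩
      rcases Finset.mem_insert.1 hu with rfl | hu
      · refine ⟨Units.map (resHom X.toPresheafedSpace (inf_le_right : V ⊓ W ≤ W)).toMonoidHom v, Units.ext ?_⟩
        rw [← hv]
        exact germ_resHom _ _ _
      · obtain ⟨v, rfl⟩ := h u hu
        exact ⟨Units.map (resHom X.toPresheafedSpace (inf_le_left : V ⊓ W ≤ V)).toMonoidHom v,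
          Units.ext (germ_resHom _ _ _)⟩
  obtain ⟨V, hV, h⟩ := hfin S
  obtain ⟨W, hW, hWV, haff⟩ := exists_affine_le hV
  refine ⟨W, hW, haff, fun u => ?_⟩
  have hle : Subgroup.closure (S : Set (X.stalk x)ˣ) ≤
      (Units.map (X.germ x hW).toMonoidHom).range := by
    rw [Subgroup.closure_le]
    intro u hu
    obtain ⟨v, rfl⟩ := h u hu
    exact ⟨Units.map (resHom X.toPresheafedSpace hWV).toMonoidHom v, Units.ext (germ_resHom _ _ _)⟩
  rw [hS] at hle
  exact hle (Subgroup.mem_top u)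

/-- A non-empty affine open set is the smallest neighbourhood of its closed point, so its sections
are a stalk. -/
theorem isCancelMulZero_of_isAffine0 (hX : X.IsIntegral) {V : Opens X.carrier}
    (hV : IsAffine0 X.toPresheafedSpace V) {x : X.carrier} (hx : x ∈ V) :
    IsCancelMulZero (X.presheaf.obj (op V)) := by
  rcases hV.eq_empty_or with h | ⟨c, hc, h⟩
  · exact absurd hx (h x)
  · have := hX c
    exact (germ_bijective hc h).1.isCancelMulZero _ (map_zero _) (map_mul _)

/-- If the unit group of the stalk at `x` is finitely generated, then `x` has a smallest open
neighbourhood, and it is affine. -/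
theorem exists_minimal_affine (hX : X.IsIntegral) {x : X.carrier} (h : Group.FG (X.stalk x)ˣ) :
    ∃ V : Opens X.carrier, x ∈ V ∧ IsAffine0 X.toPresheafedSpace V ∧
      ∀ W : Opens X.carrier, x ∈ W → V ≤ W := by
  obtain ⟨V, hx, hV, hunits⟩ := exists_affine_forall_units h
  refine ⟨V, hx, hV, fun W hW => ?_⟩
  have := isCancelMulZero_of_isAffine0 hX hV hx
  obtain ⟨c⟩ := hV.nonempty_affineCoord
  obtain ⟨a, ha, haW⟩ := c.exists_mem_D_le (V ⊓ W) inf_le_left x ⟨hx, hW⟩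
  -- No prime contains a unit, so then `D(a)` is all of `V`, while `D(a) ⊆ W`.
  suffices IsUnit a by
    refine le_trans (fun y hy => ?_) (haW.trans inf_le_right)
    rw [← SetLike.mem_coe, ← c.range_pt] at hy
    obtain ⟨p, rfl⟩ := hy
    exact (c.pt_mem_D a p).2 (p.unit_notMem this)
  have hu : IsUnit (X.germ x hx a) := by
    rw [← germ_resHom (c.D_le a) ha]
    exact ((c.isLocAway a).map_units ⟨a, 1, pow_one a⟩).map _
  -- The choice of `V` is used here: the unit germ of `a` comes from a unit `v` of `𝒪(V)`. It
  -- remains to improve equality of germs to `a = v`.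
  obtain ⟨v, hv⟩ := hunits hu.unit
  have hv' : X.germ x hx a = X.germ x hx v := (congrArg Units.val hv).symm
  obtain ⟨W', hW', hle, _, e⟩ := (germ_eq_iff _ _ _ _).1 hv'
  obtain ⟨b, hb, hbW⟩ := c.exists_mem_D_le W' hle x hW'
  have e' : resHom X.toPresheafedSpace (c.D_le b) a = resHom X.toPresheafedSpace (c.D_le b) v := by
    rw [← resHom_resHom _ hbW hle, e, resHom_resHom]
  obtain ⟨⟨_, n, rfl⟩, hn⟩ := (c.isLocAway b).exists_of_eq e'
  have hx' := hx
  rw [← SetLike.mem_coe, ← c.range_pt] at hx'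
  obtain ⟨p, rfl⟩ := hx'
  -- The factor to be cancelled is non-zero because `b` lies outside the prime `p` corresponding to
  -- `x`.
  have hbn : b ^ n ≠ 0 := fun h0 => p.pow_notMem ((c.pt_mem_D b p).1 hb) n (h0 ▸ p.zero_mem)
  rw [mul_left_cancel₀ hbn hn]
  exact v.isUnit

end M0Scheme

/-! ### The torus of units of a monoid with zero -/

theorem exists_mulEquiv_of_fg (G : Type*) [CommGroup G] [IsMulTorsionFree G] (h : Group.FG G) :
    ∃ d : ℕ, Nonempty (G ≃* Multiplicative (Fin d → ℤ)) := by
  have : Module.Finite ℤ (Additive G) := Module.Finite.iff_addGroup_fg.2 inferInstance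
  exact ⟨_, ⟨MulEquiv.toAdditive.symm
    -- A finite torsion-free `ℤ`-module is free. The `AddEquiv.refl` only retypes the target as
    -- `Additive (Multiplicative _)`.
    ((Module.finBasis ℤ (Additive G)).equivFun.toAddEquiv.trans (AddEquiv.refl _))⟩⟩

section Torus

variable {A : Type u} [CommMonoidWithZero A] [Nontrivial A] {d : ℕ}
  (e : Aˣ ≃* Multiplicative (Fin d → ℤ))

open Classical in
/-- The map that extends `e` by zero to the non-units. -/
def toTorus : A →*₀ AddMonoidAlgebra (ULift.{u} ℤ) (Fin d → ℤ) where
  toFun a := if h : IsUnit a then AddMonoidAlgebra.single (e h.unit).toAdd 1 else 0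
  map_zero' := dif_neg not_isUnit_zero
  map_one' := by
    rw [dif_pos isUnit_one, IsUnit.unit_one, map_one]
    rfl
  map_mul' a b := by
    by_cases ha : IsUnit a
    · by_cases hb : IsUnit b
      · rw [dif_pos ha, dif_pos hb, dif_pos (ha.mul hb), IsUnit.unit_mul, map_mul,
          AddMonoidAlgebra.single_mul_single, one_mul]
        rfl
      · rw [dif_neg hb, mul_zero, dif_neg (fun h => hb (isUnit_of_mul_isUnit_right h))]
    · rw [dif_neg ha, zero_mul, dif_neg (fun h => ha (isUnit_of_mul_isUnit_left h))]

theorem toTorus_unit (v : Aˣ) : toTorus e (v : A) = AddMonoidAlgebra.single (e v).toAdd 1 := by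
  refine (dif_pos v.isUnit).trans ?_
  rw [IsUnit.unit_of_val_units]

theorem toTorus_eq_zero {a : A} (h : ¬ IsUnit a) : toTorus e a = 0 := dif_neg h

/-- The surjection from `ℤ[A] / (1 · 0_A)` to the group ring of the units of `A`. -/
def torusQuot : Z0 A →+* AddMonoidAlgebra (ULift.{u} ℤ) (Fin d → ℤ) := Z0.lift (toTorus e)

theorem torusQuot_surjective : Function.Surjective (torusQuot e) := by
  intro z
  induction z using AddMonoidAlgebra.induction_linear with
  | zero => exact ⟨0, map_zero _⟩
  | add x y hx hy =>
    obtain ⟨a, rfl⟩ := hx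
    obtain ⟨b, rfl⟩ := hy
    exact ⟨a + b, map_add _ _ _⟩
  | single v n =>
    -- A monomial is an integer multiple of the image of a unit; `down` removes the universe lift on
    -- the coefficients.
    refine ⟨n.down • Z0.of A (e.symm (Multiplicative.ofAdd v) : Aˣ), ?_⟩
    rw [map_zsmul, torusQuot, Z0.lift_of, toTorus_unit, e.apply_symm_apply,
      AddMonoidAlgebra.smul_single]
    congr 1
    ext
    simp

/-- This is the universal property of the quotient by the non-units. The factorization is built from
the restriction of `φ` to the units, which avoids computing the kernel of `torusQuot e`. -/
theorem exists_comp_torusQuot {R : Type*} [CommRing R] (φ : Z0 A →+* R)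
    (h : ∀ a, ¬ IsUnit a → φ (Z0.of A a) = 0) :
    ∃ ψ : AddMonoidAlgebra (ULift.{u} ℤ) (Fin d → ℤ) →+* R, ψ.comp (torusQuot e) = φ := by
  let g : Multiplicative (Fin d → ℤ) →* R :=
    ((φ : Z0 A →* R).comp (Z0.of A).toMonoidHom).comp
      ((Units.coeHom A).comp e.symm.toMonoidHom)
  refine ⟨AddMonoidAlgebra.liftNCRingHom ((Int.castRingHom R).comp ULift.ringEquiv.toRingHom) g
    (fun _ _ => Commute.all _ _), Z0.hom_ext fun a => ?_⟩
  rw [RingHom.comp_apply, torusQuot, Z0.lift_of]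
  by_cases ha : IsUnit a
  · obtain ⟨v, rfl⟩ := ha
    rw [toTorus_unit, AddMonoidAlgebra.liftNCRingHom_single, map_one, one_mul]
    change φ (Z0.of A (e.symm (e v) : Aˣ)) = _
    rw [e.symm_apply_apply]
  · rw [toTorus_eq_zero e ha, map_zero, h a ha]

end Torus

/-! ### Points with values in fields -/

/-- `Spec k` has a single point, so whichever member of the cover contains its image receives the
whole morphism. -/
theorem exists_comp_eq_of_openCover {X : Scheme.{u}} (𝒰 : X.OpenCover) (k : Type u) [Field k]
    (z : Spec (CommRingCat.of k) ⟶ X) :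
    ∃ (i : 𝒰.I₀) (w : Spec (CommRingCat.of k) ⟶ 𝒰.X i), w ≫ 𝒰.f i = z := by
  let o : Spec (CommRingCat.of k) := (default : PrimeSpectrum k)
  obtain ⟨i, y, hy⟩ := 𝒰.exists_eq (z o)
  refine ⟨i, IsOpenImmersion.lift (𝒰.f i) z ?_, IsOpenImmersion.lift_fac _ _ _⟩
  rintro _ ⟨p, rfl⟩
  obtain rfl : p = o := Subsingleton.elim (α := PrimeSpectrum k) _ _
  exact ⟨y, hy⟩

namespace M0Scheme

variable {X : M0Scheme.{u}}

theorem map_comp_chart {U V : X.AffineOpens} (h : U ≤ V) {R : CommRingCat.{u}}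
    (φ : CommRingCat.of (Z0 (X.presheaf.obj (op U.1))) ⟶ R) :
    Spec.map (CommRingCat.ofHom (Z0.map (resHom X.toPresheafedSpace h)) ≫ φ) ≫ X.chart V =
      Spec.map φ ≫ X.chart U := by
  rw [Spec.map_comp, Category.assoc]
  congr 1
  exact colimit.w X.diagram (homOfLE h)

theorem exists_comp_chart_eq (k : Type u) [Field k]
    (z : Spec (CommRingCat.of k) ⟶ X.baseExt) :
    ∃ (U : X.AffineOpens)
      (φ : CommRingCat.of (Z0 (X.presheaf.obj (op U.1))) ⟶ CommRingCat.of k),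
      Spec.map φ ≫ X.chart U = z := by
  obtain ⟨U, w, hw⟩ := exists_comp_eq_of_openCover
    (Scheme.IsLocallyDirected.openCover X.diagram) k z
  exact ⟨U, Spec.preimage w, (congrArg (· ≫ X.chart U) (Spec.map_preimage w)).trans hw⟩

/-- Points of two charts are identified in the gluing only if they come from a chart below both.
Since that chart is open in the chart of `U`, the `k`-point `φ` lifts to it. -/
theorem exists_le_of_comp_chart_eq {U V : X.AffineOpens} {k : Type u} [Field k]
    {φ : CommRingCat.of (Z0 (X.presheaf.obj (op U.1))) ⟶ CommRingCat.of k}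
    {ψ : CommRingCat.of (Z0 (X.presheaf.obj (op V.1))) ⟶ CommRingCat.of k}
    (h : Spec.map φ ≫ X.chart U = Spec.map ψ ≫ X.chart V) :
    ∃ (W : X.AffineOpens) (hU : W ≤ U) (_ : W ≤ V)
      (χ : CommRingCat.of (Z0 (X.presheaf.obj (op W.1))) ⟶ CommRingCat.of k),
      φ = CommRingCat.ofHom (Z0.map (resHom X.toPresheafedSpace hU)) ≫ χ := by
  let o : Spec (CommRingCat.of k) := (default : PrimeSpectrum k)
  have ho : colimit.ι X.diagram U (Spec.map φ o) = colimit.ι X.diagram V (Spec.map ψ o) :=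
    congrArg (fun f : Spec (CommRingCat.of k) ⟶ X.baseExt => f o) h
  obtain ⟨W, i, j, w, hw, _⟩ := (Scheme.IsLocallyDirected.ι_eq_ι_iff X.diagram).1 ho
  let m : Spec (CommRingCat.of (Z0 (X.presheaf.obj (op W.1)))) ⟶
      Spec (CommRingCat.of (Z0 (X.presheaf.obj (op U.1)))) :=
    X.diagram.map i
  have hm : IsOpenImmersion m := inferInstanceAs (IsOpenImmersion (X.diagram.map i))
  have hr : Set.range (Spec.map φ) ⊆ Set.range m := by
    rintro _ ⟨p, rfl⟩
    obtain rfl : p = o := Subsingleton.elim (α := PrimeSpectrum k) _ _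
    exact ⟨w, hw⟩
  refine ⟨W, leOfHom i, leOfHom j, Spec.preimage (IsOpenImmersion.lift m (Spec.map φ) hr), ?_⟩
  apply Spec.map_injective
  rw [Spec.map_comp, Spec.map_preimage]
  exact (IsOpenImmersion.lift_fac m (Spec.map φ) hr).symm

/-- A point with values in a field that kills the non-units of `𝒪(U)` is not contained in a smaller
affine open subset. -/
theorem eq_of_le_of_forall_not_isUnit {W U : X.AffineOpens} (h : W ≤ U) {R : Type*} [CommRing R]
    [Nontrivial R] (χ : Z0 (X.presheaf.obj (op W.1)) →+* R)
    (hχ : ∀ a, ¬ IsUnit a → χ (Z0.map (resHom X.toPresheafedSpace h) (Z0.of _ a)) = 0) :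
    W = U := by
  obtain ⟨c⟩ := U.2.nonempty_affineCoord
  obtain ⟨d⟩ := W.2.nonempty_affineCoord
  rcases W.2.eq_empty_or with hW | ⟨x, hx, hW⟩
  -- If `W` is empty then `0 = 1` in `𝒪(W)`, since otherwise there would be a prime ideal; no
  -- homomorphism to a non-trivial ring exists.
  · exfalso
    have : (0 : X.presheaf.obj (op W.1)) = 1 := by
      by_contra h01
      obtain ⟨p, _⟩ := exists_closedPoint (1 : X.presheaf.obj (op W.1))
        (fun n => by rw [one_pow]; exact Ne.symm h01)
      apply hW (d.pt p)
      rw [← SetLike.mem_coe, ← d.range_pt]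
      exact ⟨p, rfl⟩
    have h1 : χ (Z0.of _ 0) = χ (Z0.of _ 1) :=
      congrArg (fun b => χ (Z0.of _ b)) this
    rw [map_zero, map_zero, map_one, map_one] at h1
    exact zero_ne_one h1
  -- With `x` the closed point of `W`, this forces `W = D(a)`. Then `a` is invertible on `W`, so `χ`
  -- cannot kill it, so `a` was already a unit of `𝒪(U)` and `D(a) = U`.
  · obtain ⟨a, ha, haW⟩ := c.exists_mem_D_le W.1 h x hx
    have hWa : W.1 = c.D a := le_antisymm (hW _ ha) haW
    have hu : IsUnit (resHom X.toPresheafedSpace h a) := by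
      have h1 := ((c.isLocAway a).map_units ⟨a, 1, pow_one a⟩).map
        (resHom X.toPresheafedSpace hWa.le)
      have h2 := resHom_resHom X.toPresheafedSpace hWa.le (c.D_le a) a
      exact h2 ▸ h1
    have hau : IsUnit a := by
      by_contra hcon
      have h0 := hχ a hcon
      rw [Z0.map_of] at h0
      exact ((hu.map (Z0.of _)).map χ).ne_zero h0
    refine le_antisymm h fun y hy => ?_
    rw [hWa]
    rw [← SetLike.mem_coe, ← c.range_pt] at hy
    obtain ⟨p, rfl⟩ := hy
    exact (c.pt_mem_D a p).2 (p.unit_notMem hau)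

/-! ### Properties of smallest neighbourhoods, and the torus on which a field-valued point lies. -/

/-- `U` is the smallest open neighbourhood of `x`. -/
def IsMinimalNhd (x : X.carrier) (U : X.AffineOpens) : Prop :=
  x ∈ U.1 ∧ ∀ W : Opens X.carrier, x ∈ W → U.1 ≤ W

/-- Both points lie in exactly the same open sets, and a prime is determined by the basic opens
containing it. -/
theorem IsMinimalNhd.point_eq {x y : X.carrier} {U : X.AffineOpens} (hx : IsMinimalNhd x U)
    (hy : IsMinimalNhd y U) : x = y := by
  obtain ⟨c⟩ := U.2.nonempty_affineCoord
  have h1 := hx.1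
  have h2 := hy.1
  rw [← SetLike.mem_coe, ← c.range_pt] at h1 h2
  obtain ⟨p, rfl⟩ := h1
  obtain ⟨q, rfl⟩ := h2
  congr 1
  ext a
  refine not_iff_not.1 ?_
  refine ((c.pt_mem_D a p).symm.trans ?_).trans (c.pt_mem_D a q)
  exact ⟨fun h => hx.2 _ h hy.1, fun h => hy.2 _ h hx.1⟩

theorem IsMinimalNhd.nontrivial {x : X.carrier} {U : X.AffineOpens} (hx : IsMinimalNhd x U) :
    Nontrivial (X.presheaf.obj (op U.1)) := by
  obtain ⟨c⟩ := U.2.nonempty_affineCoord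
  have h1 := hx.1
  rw [← SetLike.mem_coe, ← c.range_pt] at h1
  obtain ⟨p, _⟩ := h1
  exact ⟨0, 1, fun h => p.one_notMem (h ▸ p.zero_mem)⟩

/-- The sections over a smallest neighbourhood are the stalk, so the hypotheses on the stalk apply
to their units. -/
theorem IsMinimalNhd.exists_units_equiv {x : X.carrier} {U : X.AffineOpens}
    (hx : IsMinimalNhd x U) (hX : X.IsTorsionFree) (hX' : X.HasFGUnits) :
    ∃ d : ℕ, Nonempty ((X.presheaf.obj (op U.1))ˣ ≃* Multiplicative (Fin d → ℤ)) := by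
  have h1 := hX x
  have h2 := hX' x
  let g : X.presheaf.obj (op U.1) ≃* X.stalk x :=
    MulEquiv.ofBijective _ (germ_bijective hx.1 hx.2)
  have h3 : IsMulTorsionFree (X.stalk x)ˣ :=
    Function.Injective.isMulTorsionFree (Units.coeHom _) Units.val_injective
  obtain ⟨d, ⟨e⟩⟩ := exists_mulEquiv_of_fg (X.stalk x)ˣ h2
  exact ⟨d, ⟨(Units.mapEquiv g).trans e⟩⟩

/-- Every monoid homomorphism from `𝒪(U)` to a field factors through the residue monoid of a point. -/
theorem exists_factor_minimal {U : X.AffineOpens} {k : Type*} [Field k]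
    (φ : Z0 (X.presheaf.obj (op U.1)) →+* k) :
    ∃ x : X.carrier, ∀ V : X.AffineOpens, IsMinimalNhd x V → ∃ (h : V ≤ U)
      (ψ : Z0 (X.presheaf.obj (op V.1)) →+* k),
      ψ.comp (Z0.map (resHom X.toPresheafedSpace h)) = φ ∧
        ∀ a, ¬ IsUnit a → ψ (Z0.of _ a) = 0 := by
  obtain ⟨c⟩ := U.2.nonempty_affineCoord
  let f : X.presheaf.obj (op U.1) →*₀ k := φ.toMonoidWithZeroHom.comp (Z0.of _)
  -- The zero set of `f` is prime because a field has no zero divisors; the required point is the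
  -- one corresponding to `p`.
  let p : PrimeIdeal (X.presheaf.obj (op U.1)) :=
    { carrier := {a | f a = 0}
      zero_mem := map_zero f
      mul_mem a b h := by
        change f (a * b) = 0
        rw [map_mul, show f a = 0 from h, zero_mul]
      one_notMem h := one_ne_zero ((map_one f).symm.trans h)
      mem_or_mem a b h := by
        change f (a * b) = 0 at h
        rw [map_mul] at h
        exact mul_eq_zero.1 h }
  have hpU : c.pt p ∈ U.1 := by
    rw [← SetLike.mem_coe, ← c.range_pt]
    exact ⟨p, rfl⟩
  refine ⟨c.pt p, fun V hV => ?_⟩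
  have hVU : V ≤ U := hV.2 _ hpU
  refine ⟨hVU, ?_⟩
  -- Stated for arbitrary `a` with `V` destructured, so that `V.1 = c.D a` can be substituted in the
  -- types of the sections.
  have hloc : ∀ a, c.pt p ∈ c.D a → V.1 = c.D a → IsLocAway (resHom X.toPresheafedSpace hVU) a := by
    obtain ⟨V, hV'⟩ := V
    rintro a - rfl
    exact c.isLocAway a
  obtain ⟨a, ha, haV⟩ := c.exists_mem_D_le V.1 hVU _ hV.1
  have hVa : ∀ b, c.pt p ∈ c.D b → V.1 ≤ c.D b := fun b hb => hV.2 _ hb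
  have hla := hloc a ha (le_antisymm (hVa a ha) haV)
  have hu : ∀ y : Submonoid.powers a, IsUnit (f y) := by
    rintro ⟨_, n, rfl⟩
    have h : f (a ^ n) ≠ 0 := p.pow_notMem ((c.pt_mem_D a p).1 ha) n
    exact h.isUnit
  let F : Submonoid.LocalizationMap (Submonoid.powers a) (X.presheaf.obj (op V.1)) :=
    ⟨(resHom X.toPresheafedSpace hVU :
      X.presheaf.obj (op U.1) →ₙ* X.presheaf.obj (op V.1)), hla⟩
  let χ : X.presheaf.obj (op V.1) →*₀ k := F.lift₀ f hu
  have hχ : ∀ b, χ (resHom X.toPresheafedSpace hVU b) = f b := fun b => F.lift_eq hu b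
  refine ⟨Z0.lift χ, ?_, ?_⟩
  · apply Z0.hom_ext
    intro b
    rw [RingHom.comp_apply, Z0.map_of, Z0.lift_of, hχ]
    rfl
  · intro b hb
    rw [Z0.lift_of]
    by_contra hb0
    apply hb
    -- Clear denominators: `b` times a unit is the restriction of `b'`. As `f b' ≠ 0`, the point
    -- lies in `D(b')`; minimality gives `V ⊆ D(b')`, so `b'`, and with it `b`, is invertible on
    -- `V`.
    obtain ⟨⟨b', s⟩, hs⟩ := hla.surj b
    dsimp only at hs
    have hfb : f b' ≠ 0 := by
      rw [← hχ, ← hs, map_mul, hχ]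
      exact mul_ne_zero hb0 (hu s).ne_zero
    have hub : IsUnit (resHom X.toPresheafedSpace hVU b') := by
      have hle := hVa b' ((c.pt_mem_D b' p).2 hfb)
      have h1 := ((c.isLocAway b').map_units ⟨b', 1, pow_one b'⟩).map
        (resHom X.toPresheafedSpace hle)
      exact resHom_resHom X.toPresheafedSpace hle (c.D_le b') b' ▸ h1
    rw [← hs] at hub
    exact isUnit_of_mul_isUnit_left hub

end M0Scheme

/-! ### The tori of units inside the base extension. -/

/-- The point of the split torus that corresponds to a ring homomorphism. -/
def torusPoint {d : ℕ} {R : Type u} [CommRing R]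
    (φ : AddMonoidAlgebra (ULift.{u} ℤ) (Fin d → ℤ) →+* R) :
    Spec (CommRingCat.of R) ⟶ splitTorus.{u} d :=
  Spec.map (CommRingCat.ofHom φ)

theorem exists_torusPoint_eq {d : ℕ} {R : Type u} [CommRing R]
    (z : Spec (CommRingCat.of R) ⟶ splitTorus.{u} d) :
    ∃ φ : AddMonoidAlgebra (ULift.{u} ℤ) (Fin d → ℤ) →+* R, torusPoint φ = z :=
  ⟨(Spec.preimage z).hom, Spec.map_preimage z⟩

/-- The torus of units of `A`, as a closed subscheme of `Spec (ℤ[A] / (1 · 0_A))`. -/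
def torusIncl {A : Type u} [CommMonoidWithZero A] [Nontrivial A] {d : ℕ}
    (e : Aˣ ≃* Multiplicative (Fin d → ℤ)) :
    splitTorus.{u} d ⟶ Spec (CommRingCat.of (Z0 A)) :=
  Spec.map (CommRingCat.ofHom (torusQuot e))

instance {A : Type u} [CommMonoidWithZero A] [Nontrivial A] {d : ℕ}
    (e : Aˣ ≃* Multiplicative (Fin d → ℤ)) : IsClosedImmersion (torusIncl e) :=
  IsClosedImmersion.spec_of_surjective (CommRingCat.ofHom (torusQuot e)) (torusQuot_surjective e)

theorem torusPoint_torusIncl {A : Type u} [CommMonoidWithZero A] [Nontrivial A] {d : ℕ}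
    (e : Aˣ ≃* Multiplicative (Fin d → ℤ)) {R : Type u} [CommRing R]
    (φ : AddMonoidAlgebra (ULift.{u} ℤ) (Fin d → ℤ) →+* R) :
    torusPoint φ ≫ torusIncl e = Spec.map (CommRingCat.ofHom (φ.comp (torusQuot e))) :=
  (Spec.map_comp (CommRingCat.ofHom (torusQuot e)) (CommRingCat.ofHom φ)).symm

namespace M0Scheme

variable {X : M0Scheme.{u}}

/-- The torus of units of `𝒪(U)`, mapping to `X_ℤ` through the chart of `U`. -/
def torusMap (U : X.AffineOpens) [Nontrivial (X.presheaf.obj (op U.1))] {d : ℕ}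
    (e : (X.presheaf.obj (op U.1))ˣ ≃* Multiplicative (Fin d → ℤ)) :
    splitTorus.{u} d ⟶ X.baseExt :=
  torusIncl e ≫ X.chart U

/-- A point of the torus of `U` with values in `R` is a homomorphism on `ℤ[𝒪(U)] / (1 · 0)` that
kills the non-units. -/
theorem torusPoint_torusMap {U : X.AffineOpens} [Nontrivial (X.presheaf.obj (op U.1))] {d : ℕ}
    (e : (X.presheaf.obj (op U.1))ˣ ≃* Multiplicative (Fin d → ℤ)) {R : Type u} [CommRing R]
    (φ : AddMonoidAlgebra (ULift.{u} ℤ) (Fin d → ℤ) →+* R) :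
    torusPoint φ ≫ torusMap U e =
      Spec.map (CommRingCat.ofHom (φ.comp (torusQuot e))) ≫ X.chart U := by
  rw [torusMap, ← Category.assoc, torusPoint_torusIncl]

instance mono_torusMap {U : X.AffineOpens} [Nontrivial (X.presheaf.obj (op U.1))] {d : ℕ}
    (e : (X.presheaf.obj (op U.1))ˣ ≃* Multiplicative (Fin d → ℤ)) : Mono (torusMap U e) :=
  mono_comp (torusIncl e) (X.chart U)

/-- A common point comes from a chart `W` contained in both `U` and `V`. Points of the torus of `U`
kill the non-units of `𝒪(U)`, so `eq_of_le_of_forall_not_isUnit` forces `W = U`, and thus `U ≤ V`;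
the other inclusion is symmetric. -/
theorem eq_of_comp_torusMap_eq {k : Type u} [Field k] {U V : X.AffineOpens}
    [Nontrivial (X.presheaf.obj (op U.1))] [Nontrivial (X.presheaf.obj (op V.1))] {d d' : ℕ}
    (e : (X.presheaf.obj (op U.1))ˣ ≃* Multiplicative (Fin d → ℤ))
    (e' : (X.presheaf.obj (op V.1))ˣ ≃* Multiplicative (Fin d' → ℤ))
    (z : Spec (CommRingCat.of k) ⟶ splitTorus d) (z' : Spec (CommRingCat.of k) ⟶ splitTorus d')
    (h : z ≫ torusMap U e = z' ≫ torusMap V e') : U = V := by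
  have key : ∀ {U V : X.AffineOpens}
      [Nontrivial (X.presheaf.obj (op U.1))] [Nontrivial (X.presheaf.obj (op V.1))] {d d' : ℕ}
      (e : (X.presheaf.obj (op U.1))ˣ ≃* Multiplicative (Fin d → ℤ))
      (e' : (X.presheaf.obj (op V.1))ˣ ≃* Multiplicative (Fin d' → ℤ))
      (z : Spec (CommRingCat.of k) ⟶ splitTorus d) (z' : Spec (CommRingCat.of k) ⟶ splitTorus d')
      (_ : z ≫ torusMap U e = z' ≫ torusMap V e'), U ≤ V := by
    intro U V _ _ d d' e e' z z' h
    obtain ⟨φ, rfl⟩ := exists_torusPoint_eq z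
    obtain ⟨φ', rfl⟩ := exists_torusPoint_eq z'
    rw [torusPoint_torusMap, torusPoint_torusMap] at h
    obtain ⟨W, hU, hV, χ, hχ⟩ := exists_le_of_comp_chart_eq h
    have hWU : W = U := by
      refine eq_of_le_of_forall_not_isUnit hU χ.hom fun a ha => ?_
      refine (congrArg (fun f => f.hom (Z0.of _ a)) hχ).symm.trans ?_
      change φ (Z0.lift (toTorus e) (Z0.of _ a)) = 0
      rw [Z0.lift_of, toTorus_eq_zero e ha, map_zero]
    exact hWU ▸ hV
  exact le_antisymm (key e e' z z' h) (key e' e z' z h.symm)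

/-- Affine open sets are connected, so one containing `x` stays inside the component of `x`. -/
theorem opensRange_torusMap_le {x : X.carrier} {U : X.AffineOpens} (hU : x ∈ U.1) :
    (X.chart U).opensRange ≤ X.baseExtOpen (X.component x) :=
  le_iSup_of_le (f := fun U : {U : X.AffineOpens // U.1 ≤ X.component x} =>
    (X.chart U.1).opensRange)
    ⟨U, IsPreconnected.subset_connectedComponent U.2.isPreconnected hU⟩ le_rfl

/-! ### The decomposition of the base extension into tori. -/

/-- Smallest affine neighbourhoods of all points, with coordinates on their unit groups. -/
structure TorusAtlas (X : M0Scheme.{u}) where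
  nhd : X.carrier → X.AffineOpens
  isMinimalNhd : ∀ x, IsMinimalNhd x (nhd x)
  nontrivial : ∀ x, Nontrivial (X.presheaf.obj (op (nhd x).1))
  rank : X.carrier → ℕ
  equiv : ∀ x, (X.presheaf.obj (op (nhd x).1))ˣ ≃* Multiplicative (Fin (rank x) → ℤ)

attribute [instance] TorusAtlas.nontrivial

theorem nonempty_torusAtlas (h₁ : X.IsIntegral) (h₂ : X.IsTorsionFree) (h₃ : X.HasFGUnits) :
    Nonempty (TorusAtlas X) := by
  choose V hV haff hmin using fun x => exists_minimal_affine h₁ (h₃ x)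
  have h : ∀ x, IsMinimalNhd x ⟨V x, haff x⟩ := fun x => ⟨hV x, hmin x⟩
  choose d e using fun x => (h x).exists_units_equiv h₂ h₃
  exact ⟨⟨fun x => ⟨V x, haff x⟩, h, fun x => (h x).nontrivial, d, fun x => (e x).some⟩⟩

namespace TorusAtlas

variable (T : TorusAtlas X)

/-- The disjoint union of the tori of units. -/
abbrev tori : Scheme.{u} := ∐ fun x => splitTorus.{u} (T.rank x)

/-- The map from the disjoint union of the tori of units to the base extension. -/
def toBaseExt : T.tori ⟶ X.baseExt :=
  Sigma.desc fun x => torusMap (T.nhd x) (T.equiv x)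

theorem ι_toBaseExt (x : X.carrier) :
    Sigma.ι (fun x => splitTorus.{u} (T.rank x)) x ≫ T.toBaseExt =
      torusMap (T.nhd x) (T.equiv x) :=
  Sigma.ι_desc _ _

theorem exists_comp_ι_eq (k : Type u) [Field k] (z : Spec (CommRingCat.of k) ⟶ T.tori) :
    ∃ (x : X.carrier) (w : Spec (CommRingCat.of k) ⟶ splitTorus.{u} (T.rank x)),
      w ≫ Sigma.ι (fun x => splitTorus.{u} (T.rank x)) x = z :=
  exists_comp_eq_of_openCover (sigmaOpenCover fun x => splitTorus.{u} (T.rank x)) k z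

theorem bijective_points (k : Type u) [Field k] :
    Function.Bijective fun z : Spec (CommRingCat.of k) ⟶ T.tori => z ≫ T.toBaseExt := by
  constructor
  · intro z z' h
    obtain ⟨x, w, rfl⟩ := T.exists_comp_ι_eq k z
    obtain ⟨y, w', rfl⟩ := T.exists_comp_ι_eq k z'
    dsimp only at h
    rw [Category.assoc, Category.assoc, ι_toBaseExt, ι_toBaseExt] at h
    -- Equal images force equal neighbourhoods, hence equal indices; on a single torus the map is a
    -- monomorphism.
    have hxy := eq_of_comp_torusMap_eq _ _ _ _ h
    obtain rfl : x = y := (T.isMinimalNhd x).point_eq (hxy ▸ T.isMinimalNhd y)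
    rw [(cancel_mono _).1 h]
  · intro z
    obtain ⟨U, φ, rfl⟩ := exists_comp_chart_eq k z
    -- The zero set of `φ` selects the index `x`; the extension `ψ` kills the non-units and
    -- therefore descends to the torus.
    obtain ⟨x, hx⟩ := exists_factor_minimal φ.hom
    obtain ⟨h, ψ, hψ, hψ0⟩ := hx _ (T.isMinimalNhd x)
    obtain ⟨χ, hχ⟩ := exists_comp_torusQuot (T.equiv x) ψ hψ0
    refine ⟨torusPoint χ ≫
      Sigma.ι (fun x => splitTorus.{u} (T.rank x)) x, ?_⟩
    dsimp only
    rw [Category.assoc, ι_toBaseExt, torusPoint_torusMap, hχ, ← map_comp_chart h, ← CommRingCat.ofHom_comp, hψ]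
    rfl

end TorusAtlas

end M0Scheme

/-! ### Passage to the scheme `X`. -/

/-- The chart of `U` factors through the open subscheme of the component by a map `l`, which is
itself an open immersion. The map from the torus is then a closed immersion, followed by `l`,
followed by the immersion given by the hypothesis. -/
theorem CCScheme.isImmersion_torusMap_comp (𝒳 : CCScheme.{u}) {x : 𝒳.tilde.carrier}
    (h : IsImmersion (𝒳.eComponent x)) {U : 𝒳.tilde.AffineOpens} (hx : x ∈ U.1)
    [Nontrivial (𝒳.tilde.presheaf.obj (op U.1))] {d : ℕ}
    (e : (𝒳.tilde.presheaf.obj (op U.1))ˣ ≃* Multiplicative (Fin d → ℤ)) :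
    IsImmersion (M0Scheme.torusMap U e ≫ 𝒳.e) := by
  let O := 𝒳.tilde.baseExtOpen (𝒳.tilde.component x)
  have hr : Set.range (𝒳.tilde.chart U) ⊆ Set.range O.ι := by
    rw [Scheme.Opens.range_ι]
    exact M0Scheme.opensRange_torusMap_le hx
  let l := IsOpenImmersion.lift O.ι (𝒳.tilde.chart U) hr
  have hl : l ≫ O.ι = 𝒳.tilde.chart U := IsOpenImmersion.lift_fac _ _ _
  have : IsOpenImmersion (l ≫ O.ι) := hl ▸ inferInstance
  have : IsOpenImmersion l := IsOpenImmersion.of_comp l O.ι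
  have heq : M0Scheme.torusMap U e ≫ 𝒳.e =
      torusIncl e ≫ l ≫ 𝒳.eComponent x := by
    rw [M0Scheme.torusMap, ← hl, CCScheme.eComponent]
    simp only [Category.assoc]
    rfl
  rw [heq]
  infer_instance

end F1

end

theorem mainTheorem2 (𝒳 : F1.CCScheme.{u})
    (h_integral : 𝒳.tilde.IsIntegral) (h_torsionFree : 𝒳.tilde.IsTorsionFree)
    (h_units : 𝒳.tilde.HasFGUnits)
    (h_immersion : ∀ x : 𝒳.tilde.carrier, IsImmersion (𝒳.eComponent x)) :
    F1.IsTorified 𝒳.X := by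
  obtain ⟨T⟩ := F1.M0Scheme.nonempty_torusAtlas h_integral h_torsionFree h_units
  refine ⟨⟨𝒳.tilde.carrier, T.rank, T.toBaseExt ≫ 𝒳.e, fun x => ?_, fun k _ => ?_⟩⟩
  · rw [← Category.assoc, T.ι_toBaseExt]
    exact 𝒳.isImmersion_torusMap_comp (h_immersion x) (T.isMinimalNhd x).1 (T.equiv x)
  -- On `k`-points the torification is the torus decomposition of the base extension followed by the
  -- bijection given by `e_X`.
  · have h := (𝒳.bijective_points k).comp (T.bijective_points k)
    convert h using 2 with z
    exact (Category.assoc _ _ _).symm
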